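/- Let $M\subset\mathbb{R}^m$ be a compact piecewise-$C^2$ manifold of dimension $k\ge 1$, with or without boundary: a compact set which, with the subspace topology, is a topological $k$-manifold with or without boundary, and which is a finite union of sets $\varphi_i(K_i)$, where $K_i\subset\mathbb{R}^k$ is a compact convex set with non-empty interior and $\varphi_i:K_i\to\mathbb{R}^m$ is injective, of class $C^2$ up to the boundary of $K_i$, and an immersion in the interior of $K_i$. Let $d(x,y)\in[0,\infty]$ be the geodesic distance on $M$, i.e. the infimum of the lengths of curves in $M$ joining $x$ to $y$ ($\infty$ if there is no such curve of finite length), and let $v$ be the $k$-dimensional volume measure on $M$. Let $\mu$ be a Borel probability measure on $M$ which is equivalent to $v$ (it has the same null sets), and let $N\ge 1$. For $\mathbf{x}=(x_1,\dots,x_N)\in M^N$ let $C_j^{\mathbf{x}}=\{y\in M: d(y,x_j)=\min_{i} d(y,x_i)\}$ be the Voronoi cell of $x_j$. Given positive weights $w_1(\mathbf{x}),\dots,w_N(\mathbf{x})$, the associated thinning-replacement process is the Markov chain on $M^N$ with transition probabilities $$P(\mathbf{x},A)=\sum_{j=1}^N \mu\bigl(\{z\in M:(x_1,\dots,x_{j-1},z,x_{j+1},\dots,x_N)\in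 A\}\bigr)\,\frac{w_j(\mathbf{x})}{\sum_{i=1}^N w_i(\mathbf{x})} .$$ Thus one coordinate is selected with probability proportional to its weight and is replaced by a fresh $\mu$-distributed point. (i) ($n$-process.) Let $S:\{0,1,\dots,N-1\}\to(0,\infty)$ and $w_j(\mathbf{x})=S(\operatorname{card}\{x_i: i\ne j,\ \operatorname{card}(C_i^{\mathbf{x}}\cap C_j^{\mathbf{x}})>1\})$. Then $P$ is a Markov transition kernel and the chain is Harris ergodic. (ii) ($v$-process.) Let $\lambda$ be a finite Borel measure on $M$ equivalent to $v$, let $S:(0,\lambda(M)]\to(0,\infty)$ be a measurable function such that both $S$ and $1/S$ are locally bounded, and let $w_j(\mathbf{x})=S(\lambda(C_j^{\mathbf{x}}))$. Then $P$ is a Markov transition kernel and the chain is Harris ergodic. Here a chain is called Harris ergodic if it is positive Harris recurrent and aperiodic. That is: it has a maximal irreducibility measure $\psi$ such that, from every initial state, the chain almost surely visits every measurable set $A$ with $\psi(A)>0$ infinitely often; it has an invariant probability measure; and there are a measurable set $C$ with $\psi(C)>0$ and a finite measure $\nu$ with $\nu(C)>0$ such that the set of those $n\ge 1$ for which, for some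 $\gamma>0$, $P^{(n)}(x,A)\ge\gamma\,\nu(A)$ for all $x\in C$ and all measurable $A$, is non-empty and has greatest common divisor $1$. -/

import Mathlib

open MeasureTheory ProbabilityTheory Filter Topology
open scoped ENNReal

/-! ### Compact piecewise-`C²` manifolds in `ℝᵐ`, geodesic distance, volume measure -/

/-- `φ` parametrizes a `k`-dimensional `C²` piece of `ℝᵐ` over the convex body `K ⊆ ℝᵏ`:
it is injective, `C²` up to the boundary of `K`, and an immersion in the interior of `K`.
(Not asking for an immersion at the boundary admits pieces with cusps.) -/
structure IsC2Piece {k m : ℕ} (K : Set (EuclideanSpace ℝ (Fin k)))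
    (φ : EuclideanSpace ℝ (Fin k) → EuclideanSpace ℝ (Fin m)) : Prop where
  convex : Convex ℝ K
  isCompact : IsCompact K
  nonempty_interior : (interior K).Nonempty
  contDiffOn : ContDiffOn ℝ 2 φ K
  injOn : Set.InjOn φ K
  immersive : ∀ a ∈ interior K, Function.Injective (fderiv ℝ φ a)

/-- A compact piecewise-`C²` manifold of dimension `k ≥ 1` in `ℝᵐ`, with or without boundary:
a compact set which, with the subspace topology, is a topological `k`-manifold (with or without
boundary) and which is a finite union of `k`-dimensional `C²` pieces. -/
structure IsCompactPiecewiseC2Manifold (k : ℕ) [NeZero k] {m : ℕ}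
    (M : Set (EuclideanSpace ℝ (Fin m))) : Prop where
  isCompact : IsCompact M
  manifold : Nonempty (ChartedSpace (EuclideanHalfSpace k) M)
  pieces : ∃ (r : ℕ) (K : Fin r → Set (EuclideanSpace ℝ (Fin k)))
    (φ : Fin r → EuclideanSpace ℝ (Fin k) → EuclideanSpace ℝ (Fin m)),
    (∀ i, IsC2Piece (K i) (φ i)) ∧ M = ⋃ i, φ i '' K i

/-- The geodesic distance on `M ⊆ ℝᵐ`: the infimum of the lengths of the curves in `M` from `x`
to `y`. It is `∞` when there is no such curve of finite length. -/
noncomputable def geodesicDist {m : ℕ} {M : Set (EuclideanSpace ℝ (Fin m))} (x y : M) : ℝ≥0∞ :=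
  ⨅ γ : Path x y, eVariationOn (fun t => (γ t : EuclideanSpace ℝ (Fin m))) Set.univ

/-- The `k`-dimensional volume measure on `M ⊆ ℝᵐ`: the `k`-dimensional Hausdorff measure,
normalized so as to agree with Lebesgue measure on `ℝᵏ`. -/
noncomputable def manifoldVolume (k : ℕ) {m : ℕ} (M : Set (EuclideanSpace ℝ (Fin m))) :
    Measure M :=
  Measure.euclideanHausdorffMeasure k

/-- Two measures are equivalent if they have the same null sets. -/
def EquivalentMeasures {α : Type*} [MeasurableSpace α] (μ ν : Measure α) : Prop :=
  μ ≪ ν ∧ ν ≪ μ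

/-! ### Voronoi cells and the two selection rules -/

/-- The Voronoi cell of the generator `p` in the tessellation generated by `X`. -/
def voronoiCell {m : ℕ} {M : Set (EuclideanSpace ℝ (Fin m))} (X : Set M) (p : M) : Set M :=
  {y | ∀ q ∈ X, geodesicDist y p ≤ geodesicDist y q}

/-- The cell of the `j`-th point of the configuration `x`. -/
def configCell {m N : ℕ} {M : Set (EuclideanSpace ℝ (Fin m))} (x : Fin N → M) (j : Fin N) :
    Set M :=
  voronoiCell (Set.range x) (x j)

/-- The set of Voronoi-nearest neighbours of the `j`-th point of `x`: the points `x i`, `i ≠ j`,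
whose cell has more than one point in common with the cell of `x j`. -/
def voronoiNeighbours {m N : ℕ} {M : Set (EuclideanSpace ℝ (Fin m))} (x : Fin N → M)
    (j : Fin N) : Set M :=
  {p | ∃ i, i ≠ j ∧ x i = p ∧ (configCell x i ∩ configCell x j).Nontrivial}

/-- The selection function of the `n`-process, as a function of the number of neighbours. -/
noncomputable def neighbourWeight {m N : ℕ} {M : Set (EuclideanSpace ℝ (Fin m))} (S : ℕ → ℝ)
    (x : Fin N → M) (j : Fin N) : ℝ :=
  S (voronoiNeighbours x j).ncard

/-- The selection function of the `v`-process, as a function of the `lam`-volume of the cell. -/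
noncomputable def volumeWeight {m N : ℕ} {M : Set (EuclideanSpace ℝ (Fin m))} (lam : Measure M)
    (S : ℝ → ℝ) (x : Fin N → M) (j : Fin N) : ℝ :=
  S (lam.real (configCell x j))

/-- The probability that, in the configuration `x`, the point with index `j` is selected. -/
noncomputable def selectionProb {N : ℕ} {α : Type*} (w : (Fin N → α) → Fin N → ℝ)
    (x : Fin N → α) (j : Fin N) : ℝ :=
  w x j / ∑ i, w x i

/-- `P` is the transition kernel of the thinning-replacement process on `αᴺ` with selection
weights `w` and replacement law `μ`. -/
def IsThinningReplacementKernel {N : ℕ} {α : Type*} [MeasurableSpace α] (μ : Measure α)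
    (w : (Fin N → α) → Fin N → ℝ) (P : Kernel (Fin N → α) (Fin N → α)) : Prop :=
  ∀ (x : Fin N → α) (A : Set (Fin N → α)), MeasurableSet A →
    P x A = ∑ j, μ {z | Function.update x j z ∈ A} * ENNReal.ofReal (selectionProb w x j)

/-- `f` is locally bounded on `s`: each point of `s` has a neighbourhood in `s` on which `f` is
bounded. -/
def LocallyBoundedOn (f : ℝ → ℝ) (s : Set ℝ) : Prop :=
  ∀ v ∈ s, ∃ C : ℝ, ∀ᶠ u in 𝓝[s] v, |f u| ≤ C

/-! ### Harris ergodicity of a Markov chain -/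

section Harris

variable {X : Type*} [MeasurableSpace X]

/-- The law on path space of the Markov chain with transition kernel `P` started at `x`. -/
noncomputable def chainLaw (P : Kernel X X) [IsMarkovKernel P] (x : X) : Measure (ℕ → X) :=
  Kernel.traj (X := fun _ => X)
    (fun n => P.comap (fun h : (i : Finset.Iic n) → X => h ⟨n, Finset.mem_Iic.2 le_rfl⟩)
      (measurable_pi_apply _)) 0 (fun _ => x)

/-- `ψ` is a maximal irreducibility measure for `P`: the chain is `ψ`-irreducible, and every
irreducibility measure is absolutely continuous with respect to `ψ`. -/
structure IsMaximalIrreducibilityMeasure (P : Kernel X X) (ψ : Measure X) : Prop where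
  sigmaFinite : SigmaFinite ψ
  ne_zero : ψ ≠ 0
  irreducible : Kernel.IsIrreducible ψ P
  maximal : ∀ ψ' : Measure X, SigmaFinite ψ' → Kernel.IsIrreducible ψ' P → ψ' ≪ ψ

/-- The exponents `n ≥ 1` for which `C` is a small set for a multiple of the measure `ν`. -/
def smallExponents (P : Kernel X X) (C : Set X) (ν : Measure X) : Set ℕ :=
  {n | 1 ≤ n ∧ ∃ γ : ℝ≥0∞, 0 < γ ∧ ∀ x ∈ C, ∀ A, MeasurableSet A → γ * ν A ≤ (P ^ n) x A}

/-- Aperiodicity of a `ψ`-irreducible chain: for some small set `C` of positive `ψ`-measure, with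
minorizing measure `ν` charging `C`, the set of exponents has greatest common divisor `1`. -/
def IsAperiodicChain (P : Kernel X X) (ψ : Measure X) : Prop :=
  ∃ (C : Set X) (ν : Measure X), MeasurableSet C ∧ 0 < ψ C ∧ IsFiniteMeasure ν ∧ 0 < ν C ∧
    (smallExponents P C ν).Nonempty ∧ ∀ d : ℕ, (∀ n ∈ smallExponents P C ν, d ∣ n) → d = 1

/-- Harris ergodicity: the chain is Harris recurrent (it is `ψ`-irreducible, and from every initial
state it almost surely visits infinitely often each set of positive `ψ`-measure, `ψ` a maximal
irreducibility measure), positive (there is an invariant probability), and aperiodic. -/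
def IsHarrisErgodic (P : Kernel X X) [IsMarkovKernel P] : Prop :=
  ∃ ψ : Measure X, IsMaximalIrreducibilityMeasure P ψ ∧
    (∀ A, MeasurableSet A → 0 < ψ A → ∀ x, ∀ᵐ ω ∂(chainLaw P x), ∃ᶠ n in atTop, ω n ∈ A) ∧
    (∃ π : Measure X, IsProbabilityMeasure π ∧ Kernel.Invariant P π) ∧
    IsAperiodicChain P ψ

end Harris

/-! Both chains satisfy Doeblin's condition: some iterate of `P` dominates a fixed nonzero finite
measure, uniformly over all initial states. This is enough for Harris ergodicity
(`isHarrisErgodic_of_minorized`), so all that remains is to find the minorization.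

For the `n`-process the weights take finitely many positive values. Every index is thus selected
with probability at least some δ > 0, and selecting all indices once in a prescribed order gives `P
^ N ≥ δ ^ N • μ ^ N`, where `μ ^ N` is the product measure.

For the `v`-process `S` may degenerate near 0, so a point with a small cell may be selected only
rarely, or may take almost all of the selection probability. The remedy is to separate the points. A
point at distance at least 2η from all others has a cell containing its η-ball, and its weight lies
in a fixed interval `[a, C]`. As long as some points are not separated, one of them has a cell of
volume at least β/N, hence weight at least `a`; comparison with the largest weight then yields a
non-separated index selected with probability at least a/(NC). That point can be moved to a free
ball among N+1 parking balls. After N such moves all points are separated, but the order of the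
moves depends on the configuration. A second round of N moves, now in a fixed order, takes the
`i`-th point to its own target ball and produces a product measure independent of the start.

The geometry needed is that the geodesic distance is continuous
(`IsCompactPiecewiseC2Manifold.continuous_geodesicDist`) and that nonempty open sets have positive
volume (`IsCompactPiecewiseC2Manifold.manifoldVolume_ne_zero`). -/

/-! ### Doeblin's condition implies Harris ergodicity -/

section Doeblin

variable {X : Type*} [MeasurableSpace X]

instance isMarkovKernel_pow (P : Kernel X X) [IsMarkovKernel P] (n : ℕ) :
    IsMarkovKernel (P ^ n) := by
  induction n with
  | zero => exact inferInstanceAs (IsMarkovKernel (Kernel.id : Kernel X X))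
  | succ n ih =>
    rw [pow_succ]
    exact inferInstanceAs (IsMarkovKernel ((P ^ n) ∘ₖ P))

lemma lintegral_kernel_pow_succ (P : Kernel X X) (n : ℕ) (x : X) {g : X → ℝ≥0∞}
    (hg : Measurable g) :
    ∫⁻ y, g y ∂(P ^ (n + 1)) x = ∫⁻ y, ∫⁻ z, g z ∂P y ∂(P ^ n) x := by
  rw [pow_succ']
  exact Kernel.lintegral_comp P (P ^ n) x hg

instance isProbabilityMeasure_chainLaw (P : Kernel X X) [IsMarkovKernel P] (x : X) :
    IsProbabilityMeasure (chainLaw P x) := by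
  unfold chainLaw; infer_instance

/-- One-step Markov property of the chain. -/
lemma setLIntegral_chainLaw_succ (P : Kernel X X) [IsMarkovKernel P] (x : X) (b : ℕ)
    {E : Set (ℕ → X)} (hE : MeasurableSet[Filtration.piLE (X := fun _ => X) b] E)
    {g : X → ℝ≥0∞} (hg : Measurable g) :
    ∫⁻ ω in E, g (ω (b + 1)) ∂chainLaw P x =
      ∫⁻ ω in E, ∫⁻ y, g y ∂P (ω b) ∂chainLaw P x := by
  rw [Filtration.piLE_eq_comap_frestrictLe] at hE
  obtain ⟨F, hF, rfl⟩ := hE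
  have hPg : Measurable fun y => ∫⁻ z, g z ∂P y := hg.lintegral_kernel
  let κ : (n : ℕ) → Kernel ((i : Finset.Iic n) → X) X := fun n =>
    P.comap (fun h : (i : Finset.Iic n) → X => h ⟨n, Finset.mem_Iic.2 le_rfl⟩)
      (measurable_pi_apply _)
  -- Disintegration of the joint law of the history up to time `b` and the next state.
  have key := Kernel.partialTraj_compProd_eq_map_traj (X := fun _ => X) (κ := κ)
    (Nat.zero_le b) (x₀ := fun _ => x)
  have hmf : Measurable fun p : ((i : Finset.Iic b) → X) × X => F.indicator 1 p.1 * g p.2 :=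
    ((measurable_one.indicator hF).comp measurable_fst).mul (hg.comp measurable_snd)
  have hmr : Measurable (fun ω : ℕ → X => (Preorder.frestrictLe (π := fun _ => X) b ω, ω (b + 1))) := by
    fun_prop
  have h1 : ∫⁻ ω in Preorder.frestrictLe (π := fun _ => X) b ⁻¹' F, g (ω (b + 1)) ∂chainLaw P x
      = ∫⁻ p, F.indicator 1 p.1 * g p.2 ∂((Kernel.traj (X := fun _ => X) κ 0 (fun _ => x)).map
        (fun ω => (Preorder.frestrictLe b ω, ω (b + 1)))) := by
    rw [lintegral_map hmf hmr, ← lintegral_indicator (hF.preimage (by fun_prop))]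
    refine lintegral_congr fun ω => ?_
    by_cases h : Preorder.frestrictLe (π := fun _ => X) b ω ∈ F <;> simp [Set.indicator, h]
  rw [h1, ← key, Measure.lintegral_compProd hmf, ← Kernel.traj_map_frestrictLe_apply, lintegral_map]
  · rw [← lintegral_indicator (hF.preimage (by fun_prop))]
    refine lintegral_congr fun ω => ?_
    by_cases h : Preorder.frestrictLe (π := fun _ => X) b ω ∈ F <;> simp [Set.indicator, h, κ]
  · exact hmf.lintegral_kernel_prod_right'
  · fun_prop

/-- Markov property of the chain, over several steps. -/
lemma setLIntegral_chainLaw_add (P : Kernel X X) [IsMarkovKernel P] (x : X) (b l : ℕ)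
    {E : Set (ℕ → X)} (hE : MeasurableSet[Filtration.piLE (X := fun _ => X) b] E)
    {g : X → ℝ≥0∞} (hg : Measurable g) :
    ∫⁻ ω in E, g (ω (b + l)) ∂chainLaw P x =
      ∫⁻ ω in E, ∫⁻ y, g y ∂(P ^ l) (ω b) ∂chainLaw P x := by
  induction l generalizing g with
  | zero =>
    refine lintegral_congr fun ω => ?_
    rw [pow_zero]
    exact (Kernel.lintegral_id' hg _).symm
  | succ l ih =>
    rw [← add_assoc, setLIntegral_chainLaw_succ P x (b + l)
      ((Filtration.piLE (X := fun _ => X)).mono (Nat.le_add_right b l) _ hE) hg,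
      ih hg.lintegral_kernel]
    refine lintegral_congr fun ω => ?_
    rw [lintegral_kernel_pow_succ P l _ hg]

lemma chainLaw_inter_notMem_le (P : Kernel X X) [IsMarkovKernel P] (x : X) (b l : ℕ)
    {E : Set (ℕ → X)} (hE : MeasurableSet[Filtration.piLE (X := fun _ => X) b] E)
    {A : Set X} (hA : MeasurableSet A) {c : ℝ≥0∞} (hc : ∀ y, c ≤ (P ^ l) y A) :
    chainLaw P x (E ∩ (fun ω => ω (b + l)) ⁻¹' Aᶜ) ≤ (1 - c) * chainLaw P x E := by
  have hE' : MeasurableSet E := (Filtration.piLE (X := fun _ => X)).le b _ hE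
  have hm : MeasurableSet ((fun ω : ℕ → X => ω (b + l)) ⁻¹' Aᶜ) := (measurable_pi_apply (b + l)) hA.compl
  have h := setLIntegral_chainLaw_add P x b l hE (g := Aᶜ.indicator 1)
    (measurable_one.indicator hA.compl)
  have h1 : ∫⁻ ω in E, Aᶜ.indicator (1 : X → ℝ≥0∞) (ω (b + l)) ∂chainLaw P x
      = chainLaw P x (E ∩ (fun ω => ω (b + l)) ⁻¹' Aᶜ) := by
    rw [Set.inter_comm, ← Measure.restrict_apply hm, ← lintegral_indicator_one hm]
    rfl
  rw [← h1, h]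
  calc _ ≤ ∫⁻ ω in E, (1 - c) ∂chainLaw P x := by
        refine lintegral_mono fun ω => ?_
        rw [lintegral_indicator_one hA.compl, prob_compl_eq_one_sub hA]
        exact tsub_le_tsub_left (hc _) _
    _ = _ := by rw [setLIntegral_const]

/-- A set that is reached in `l` steps with a probability bounded below is visited infinitely
often. -/
lemma ae_frequently_mem_of_le_pow (P : Kernel X X) [IsMarkovKernel P] {A : Set X}
    (hA : MeasurableSet A) {l : ℕ} {c : ℝ≥0∞} (hc0 : 0 < c) (hc : ∀ y, c ≤ (P ^ l) y A) (x : X) :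
    ∀ᵐ ω ∂chainLaw P x, ∃ᶠ n in atTop, ω n ∈ A := by
  -- Missing `A` at the `K` times `m + l, ..., m + K * l` costs a factor `1 - c` each time.
  have hK (m K : ℕ) : MeasurableSet[Filtration.piLE (X := fun _ => X) (m + K * l)]
        {ω : ℕ → X | ∀ j < K, ω (m + (j + 1) * l) ∉ A} ∧
      chainLaw P x {ω : ℕ → X | ∀ j < K, ω (m + (j + 1) * l) ∉ A} ≤ (1 - c) ^ K := by
    induction K with
    | zero => exact ⟨by simp, by simp⟩
    | succ K ih =>
      have hs : {ω : ℕ → X | ∀ j < K + 1, ω (m + (j + 1) * l) ∉ A} =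
          {ω : ℕ → X | ∀ j < K, ω (m + (j + 1) * l) ∉ A} ∩ (fun ω => ω ((m + K * l) + l)) ⁻¹' Aᶜ := by
        ext ω
        simp only [Set.mem_ofPred_eq, Set.mem_inter_iff, Set.mem_preimage, Set.mem_compl_iff, Nat.lt_succ_iff_lt_or_eq, or_imp,
          forall_and, forall_eq, add_mul, one_mul, add_assoc]
      have he : m + (K + 1) * l = (m + K * l) + l := by ring
      rw [hs, he]
      refine ⟨?_, ?_⟩
      · refine MeasurableSet.inter ((Filtration.piLE (X := fun _ => X)).mono
          (Nat.le_add_right _ l) _ ih.1) ?_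
        rw [Filtration.piLE_eq_comap_frestrictLe]
        exact ⟨(fun h => h ⟨m + K * l + l, Finset.mem_Iic.2 le_rfl⟩) ⁻¹' Aᶜ,
          measurable_pi_apply _ hA.compl, rfl⟩
      · refine (chainLaw_inter_notMem_le P x _ l ih.1 hA hc).trans ?_
        rw [pow_succ']
        gcongr
        exact ih.2
  have h0 (m : ℕ) : chainLaw P x {ω | ∀ n ≥ m, ω n ∉ A} = 0 := by
    have hlt : 1 - c < 1 := ENNReal.sub_lt_self ENNReal.one_ne_top one_ne_zero hc0.ne'
    refine le_antisymm (ge_of_tendsto' (ENNReal.tendsto_pow_atTop_nhds_zero_of_lt_one hlt)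
      fun K => (measure_mono ?_).trans (hK m K).2) zero_le
    intro ω hω j _
    exact hω _ (Nat.le_add_right _ _)
  have h1 : ∀ᵐ ω ∂chainLaw P x, ∀ m, ¬ ∀ n ≥ m, ω n ∉ A :=
    ae_all_iff.2 fun m => by simpa [ae_iff] using h0 m
  filter_upwards [h1] with ω hω
  rw [frequently_atTop]
  intro m
  simpa using hω m

/-- The extra step can be taken first, since the bound holds from every state. -/
lemma le_pow_succ_apply {P : Kernel X X} [IsMarkovKernel P] {n : ℕ} {ν : Measure X}
    (h : ∀ x A, MeasurableSet A → ν A ≤ (P ^ n) x A) (x : X) {A : Set X} (hA : MeasurableSet A) :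
    ν A ≤ (P ^ (n + 1)) x A := by
  rw [add_comm, Kernel.pow_add_apply_eq_lintegral P 1 n x hA]
  calc ν A = ∫⁻ _, ν A ∂(P ^ 1) x := by simp
    _ ≤ _ := lintegral_mono fun y => h y A hA

lemma lintegral_le_pow_add_apply {P : Kernel X X} {n : ℕ} {ν : Measure X}
    (h : ∀ x A, MeasurableSet A → ν A ≤ (P ^ n) x A) (l : ℕ) (x : X) {A : Set X}
    (hA : MeasurableSet A) :
    ∫⁻ y, (P ^ l) y A ∂ν ≤ (P ^ (n + l)) x A := by
  rw [Kernel.pow_add_apply_eq_lintegral P n l x hA]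
  exact lintegral_mono' (Measure.le_iff.2 fun s hs => h x s hs) le_rfl

/-- A kernel minorized by a nonzero measure has an invariant probability measure. -/
lemma exists_invariant_of_minorized (Q : Kernel X X) [IsMarkovKernel Q] (ν : Measure X)
    [IsFiniteMeasure ν] (hν : ν ≠ 0) (h : ∀ x, ν ≤ Q x) :
    ∃ π : Measure X, IsProbabilityMeasure π ∧ Kernel.Invariant Q π := by
  have hsub (x : X) {A : Set X} (hA : MeasurableSet A) : (Q x - ν) A = Q x A - ν A :=
    Measure.sub_apply hA (h x)
  -- The invariant measure is the series `∑ ν R ^ k` for the residual kernel `R = Q - ν`. Its mass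
  -- is a geometric series with sum 1, and applying `Q = R + ν` shifts the series and restores the
  -- term `ν`.
  let R : Kernel X X := ⟨fun x => Q x - ν, by
    refine Measure.measurable_of_measurable_coe _ fun A hA => ?_
    simp_rw [hsub _ hA]
    exact (Q.measurable_coe hA).sub_const _⟩
  have hR (x : X) {A : Set X} (hA : MeasurableSet A) : R x A = Q x A - ν A := hsub x hA
  let a : ℕ → Measure X := fun k => Nat.rec ν (fun _ m => m.bind R) k
  have ha0 : a 0 = ν := rfl
  have ha (k : ℕ) {A : Set X} (hA : MeasurableSet A) : a (k + 1) A = ∫⁻ x, R x A ∂a k :=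
    Measure.bind_apply hA R.aemeasurable
  set c := ν Set.univ
  have hc0 : c ≠ 0 := by simpa [c] using hν
  have hc1 : c ≤ 1 := by
    obtain ⟨x⟩ : Nonempty X := by
      by_contra hX
      rw [not_nonempty_iff] at hX
      exact hν (Measure.eq_zero_of_isEmpty ν)
    simpa using h x Set.univ
  have hmass (k : ℕ) : a k Set.univ = (1 - c) ^ k * c := by
    induction k with
    | zero => simp [ha0, c]
    | succ k ih =>
      rw [ha k .univ]
      simp only [hR _ .univ, measure_univ, lintegral_const, ih]
      rw [pow_succ', mul_assoc]
  have hπ : Measure.sum a Set.univ = 1 := by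
    rw [Measure.sum_apply _ .univ]
    simp_rw [hmass]
    rw [ENNReal.tsum_mul_right, ENNReal.tsum_geometric, ENNReal.sub_sub_cancel ENNReal.one_ne_top hc1]
    exact ENNReal.inv_mul_cancel hc0 (measure_ne_top _ _)
  refine ⟨Measure.sum a, ⟨hπ⟩, ?_⟩
  ext A hA
  rw [Measure.bind_apply hA Q.aemeasurable]
  have hQ (x : X) : Q x A = R x A + ν A := by
    rw [hR x hA, tsub_add_cancel_of_le (h x A)]
  simp_rw [hQ]
  rw [lintegral_add_right _ measurable_const, lintegral_const, hπ, mul_one,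
    lintegral_sum_measure, Measure.sum_apply _ hA,
    tsum_eq_zero_add' (f := fun k => a k A) ENNReal.summable, ha0, add_comm]
  exact congrArg (ν A + ·) (tsum_congr fun k => (ha k hA).symm)

/-- If a power of `P` has an invariant probability measure, then so has `P`. -/
lemma exists_invariant_of_pow (P : Kernel X X) [IsMarkovKernel P] {n : ℕ} (hn : n ≠ 0)
    {π : Measure X} [IsProbabilityMeasure π] (h : Kernel.Invariant (P ^ n) π) :
    ∃ π' : Measure X, IsProbabilityMeasure π' ∧ Kernel.Invariant P π' := by
  have hs (i : ℕ) {A : Set X} (hA : MeasurableSet A) :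
      ∫⁻ x, P x A ∂(π.bind (P ^ i)) = π.bind (P ^ (i + 1)) A := by
    rw [Measure.lintegral_bind (P ^ i).aemeasurable (P.measurable_coe hA).aemeasurable,
      Measure.bind_apply hA (P ^ (i + 1)).aemeasurable]
    simp_rw [Kernel.pow_succ_apply_eq_lintegral P i _ hA]
  refine ⟨(n : ℝ≥0∞)⁻¹ • ∑ i ∈ Finset.range n, π.bind (P ^ i), ⟨?_⟩, ?_⟩
  · have h1 (i : ℕ) : π.bind (P ^ i) Set.univ = 1 := by
      rw [Measure.bind_apply .univ (P ^ i).aemeasurable]; simp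
    simp only [Measure.smul_apply, Measure.coe_finsetSum, Finset.sum_apply, h1, smul_eq_mul,
      Finset.sum_const, Finset.card_range, nsmul_eq_mul, mul_one]
    exact ENNReal.inv_mul_cancel (by exact_mod_cast hn) (ENNReal.natCast_ne_top n)
  · ext A hA
    rw [Measure.bind_apply hA P.aemeasurable, lintegral_smul_measure, lintegral_finsetSum_measure]
    simp only [hs _ hA, Measure.smul_apply, Measure.coe_finsetSum, Finset.sum_apply]
    congr 1
    have h0 : π.bind (P ^ 0 : Kernel X X) = π := by
      rw [pow_zero]; exact Measure.bind_dirac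
    -- For the average of `π P ^ i` over `i < n`, applying `P` shifts the sum; the terms `i = 0` and
    -- `i = n` agree by invariance and cancel, being finite.
    have e1 := Finset.sum_range_succ (fun i => π.bind (P ^ i) A) n
    have e2 := Finset.sum_range_succ' (fun i => π.bind (P ^ i) A) n
    simp only [h0, h.def] at e1 e2
    rw [e1] at e2
    exact ((ENNReal.add_left_inj (measure_ne_top _ _)).1 e2).symm

/-- A Markov kernel one of whose iterates is minorized, on the whole state space, by a nonzero
measure (Doeblin's condition) is Harris ergodic. -/
theorem isHarrisErgodic_of_minorized (P : Kernel X X) [IsMarkovKernel P] (n : ℕ) (ν : Measure X)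
    [IsFiniteMeasure ν] (hν : ν ≠ 0)
    (h : ∀ x A, MeasurableSet A → ν A ≤ (P ^ n) x A) : IsHarrisErgodic P := by
  have hX : Nonempty X := by
    by_contra hX
    rw [not_nonempty_iff] at hX
    exact hν (Measure.eq_zero_of_isEmpty ν)
  -- Passing to `n + 1` covers `n = 0`: the exponents of small sets must be positive.
  have hsucc : ∀ x A, MeasurableSet A → ν A ≤ (P ^ (n + 1)) x A :=
    fun x A hA => le_pow_succ_apply h x hA
  -- The null sets of `ψ` are those that are null for every `ν P ^ l`; the geometric weights keep
  -- `ψ` finite.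
  let ψ : Measure X := Measure.sum fun l : ℕ => (2⁻¹ : ℝ≥0∞) ^ l • ν.bind (P ^ l)
  have hbind (l : ℕ) {A : Set X} (hA : MeasurableSet A) :
      ν.bind (P ^ l) A = ∫⁻ y, (P ^ l) y A ∂ν := Measure.bind_apply hA (P ^ l).aemeasurable
  have hψ0 {A : Set X} (hA : MeasurableSet A) : ψ A = 0 ↔ ∀ l : ℕ, ν.bind (P ^ l) A = 0 := by
    simp [ψ, Measure.sum_apply _ hA, ENNReal.tsum_eq_zero]
  have hψpos {A : Set X} (hA : MeasurableSet A) (hpos : 0 < ψ A) :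
      ∃ l : ℕ, 0 < ∫⁻ y, (P ^ l) y A ∂ν := by
    by_contra! hcon
    exact hpos.ne' ((hψ0 hA).2 fun l => by rw [hbind l hA]; exact le_antisymm (hcon l) zero_le)
  have hψuniv : ψ Set.univ = 2 * ν Set.univ := by
    have h1 (l : ℕ) : ν.bind (P ^ l) Set.univ = ν Set.univ := by simp [hbind l .univ]
    simp only [ψ, Measure.sum_apply _ .univ, Measure.smul_apply, h1, smul_eq_mul]
    rw [ENNReal.tsum_mul_right, ENNReal.tsum_geometric, ENNReal.one_sub_inv_two, inv_inv]
  have hνu : ν Set.univ ≠ 0 := by simpa using hν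
  have hfin : IsFiniteMeasure ψ := ⟨by rw [hψuniv]; exact ENNReal.mul_lt_top (by simp) (measure_lt_top _ _)⟩
  refine ⟨ψ, ⟨inferInstance, ?_, ⟨fun A hA hpos x => ?_⟩, fun ψ' _ hψ' => ?_⟩,
    fun A hA hpos x => ?_, ?_, ?_⟩
  · intro h0
    rw [h0] at hψuniv
    exact hνu (by simpa using hψuniv.symm)
  · obtain ⟨l, hl⟩ := hψpos hA hpos
    exact ⟨n + l, hl.trans_le (lintegral_le_pow_add_apply h l x hA)⟩
  · refine Measure.AbsolutelyContinuous.mk fun A hA h0 => ?_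
    by_contra hne
    -- From `ν`-almost every state a `ψ`-null set is never reached with positive probability; one
    -- such state contradicts `ψ'`-irreducibility.
    have h2 : ∀ l : ℕ, ∀ᵐ y ∂ν, (P ^ l) y A = 0 := fun l => by
      have := (hψ0 hA).1 h0 l
      rwa [hbind l hA, lintegral_eq_zero_iff ((P ^ l).measurable_coe hA)] at this
    have : NeZero ν := ⟨hν⟩
    obtain ⟨y, hy⟩ := (ae_all_iff.2 h2).exists
    obtain ⟨l, hl⟩ := hψ'.irreducible hA (pos_iff_ne_zero.2 hne) y
    exact hl.ne' (hy l)
  · obtain ⟨l, hl⟩ := hψpos hA hpos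
    exact ae_frequently_mem_of_le_pow P hA hl (fun y => lintegral_le_pow_add_apply h l y hA) x
  · obtain ⟨π, hπ, hinv⟩ := exists_invariant_of_minorized (P ^ (n + 1)) ν hν
      fun x => Measure.le_iff.2 fun s hs => hsucc x s hs
    exact exists_invariant_of_pow P n.succ_ne_zero hinv
  · have hmem (j : ℕ) (hj : ∀ x A, MeasurableSet A → ν A ≤ (P ^ j) x A) (hj1 : 1 ≤ j) :
        j ∈ smallExponents P Set.univ ν :=
      ⟨hj1, 1, one_pos, fun x _ A hA => by simpa using hj x A hA⟩
    -- Two consecutive exponents force the greatest common divisor to be 1.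
    have m1 := hmem (n + 1) hsucc (by lia)
    have m2 := hmem (n + 2) (fun x A hA => le_pow_succ_apply hsucc x hA) (by lia)
    refine ⟨Set.univ, ν, .univ, ?_, inferInstance, pos_iff_ne_zero.2 hνu, ⟨_, m1⟩, fun d hd => ?_⟩
    · rw [hψuniv]; exact pos_iff_ne_zero.2 (mul_ne_zero two_ne_zero hνu)
    · have := (Nat.dvd_add_right (hd _ m1)).1 (show d ∣ (n + 1) + 1 from hd _ m2)
      exact Nat.dvd_one.1 this

end Doeblin

/-! ### Lower bounds for selection probabilities -/

section SelectionProb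

variable {N : ℕ} {α : Type*} {w : (Fin N → α) → Fin N → ℝ}

lemma le_selectionProb [NeZero N] {x : Fin N → α} {j : Fin N} {c C : ℝ}
    (hpos : ∀ i, 0 < w x i) (hC : ∀ i, w x i ≤ C) (hj : c ≤ w x j) :
    c / (N * C) ≤ selectionProb w x j := by
  have hs : 0 < ∑ i, w x i := Finset.sum_pos (fun i _ => hpos i) ⟨j, Finset.mem_univ _⟩
  refine div_le_div₀ (hpos j).le hj hs ?_
  simpa using Finset.sum_le_sum (s := Finset.univ) fun i _ => hC i

/-- If the weights of the indices in `G` are bounded and some other weight is not too small, then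
some index outside `G` has a selection probability that is not too small. -/
lemma exists_le_selectionProb [NeZero N] {x : Fin N → α} {G : Finset (Fin N)} {c C : ℝ}
    (hpos : ∀ i, 0 < w x i) (hC : ∀ i ∈ G, w x i ≤ C) (hc : 0 < c) (hcC : c ≤ C)
    (hj : ∃ j ∉ G, c ≤ w x j) : ∃ j ∉ G, c / (N * C) ≤ selectionProb w x j := by
  -- Look at an index of maximal weight. If it lies in `G`, all weights are at most `C`; otherwise
  -- it is itself selected with probability at least `1 / N`.
  obtain ⟨i, -, hi⟩ := Finset.exists_max_image Finset.univ (w x) ⟨0, Finset.mem_univ _⟩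
  by_cases hiG : i ∈ G
  · obtain ⟨j, hjG, hcj⟩ := hj
    exact ⟨j, hjG, le_selectionProb hpos (fun l => (hi l (Finset.mem_univ l)).trans (hC i hiG)) hcj⟩
  · refine ⟨i, hiG, le_trans ?_
      (le_selectionProb hpos (fun l => hi l (Finset.mem_univ l)) le_rfl)⟩
    have hN : (0 : ℝ) < N := Nat.cast_pos.2 (NeZero.pos N)
    rw [div_le_div_iff₀ (mul_pos hN (hc.trans_le hcC)) (mul_pos hN (hpos i))]
    nlinarith [mul_le_mul_of_nonneg_right hcC (mul_pos hN (hpos i)).le]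

end SelectionProb

/-! ### The transition kernel and its iterates -/

section ThinningReplacement

variable {N : ℕ} {α : Type*} [MeasurableSpace α]

/-- The thinning-replacement process with measurable positive weights has a transition kernel. -/
lemma exists_thinningReplacementKernel (hN : 1 ≤ N) (μ : Measure α) [IsProbabilityMeasure μ]
    {w : (Fin N → α) → Fin N → ℝ} (hw : ∀ j, Measurable fun x => w x j)
    (hpos : ∀ x j, 0 < w x j) :
    ∃ (P : Kernel (Fin N → α) (Fin N → α)) (_ : IsMarkovKernel P),
      IsThinningReplacementKernel μ w P := by
  have hup (x : Fin N → α) (j : Fin N) : Measurable (Function.update x j) := measurable_update x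
  have hval (x : Fin N → α) {A : Set (Fin N → α)} (hA : MeasurableSet A) :
      (∑ j, ENNReal.ofReal (selectionProb w x j) • μ.map (Function.update x j)) A =
        ∑ j, μ {z | Function.update x j z ∈ A} * ENNReal.ofReal (selectionProb w x j) := by
    simp only [Measure.coe_finsetSum, Finset.sum_apply, Measure.smul_apply, smul_eq_mul]
    refine Finset.sum_congr rfl fun j _ => ?_
    rw [Measure.map_apply (hup x j) hA, mul_comm]
    rfl
  let P : Kernel (Fin N → α) (Fin N → α) :=
    ⟨fun x => ∑ j, ENNReal.ofReal (selectionProb w x j) • μ.map (Function.update x j), by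
      refine Measure.measurable_of_measurable_coe _ fun A hA => ?_
      simp_rw [hval _ hA]
      refine Finset.measurable_fun_sum _ fun j _ => Measurable.mul ?_ ?_
      · have hm : Measurable fun p : (Fin N → α) × α => Function.update p.1 j p.2 := by
          refine measurable_pi_lambda _ fun i => ?_
          by_cases h : i = j
          · subst h; simpa using measurable_snd
          · simpa [Function.update_of_ne h] using measurable_fst.eval
        exact measurable_measure_prodMk_left (hm hA)
      · exact ((hw j).div (Finset.measurable_fun_sum _ fun i _ => hw i)).ennreal_ofReal⟩
  have hP : IsThinningReplacementKernel μ w P := fun x A hA => hval x hA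
  refine ⟨P, ⟨fun x => ⟨?_⟩⟩, hP⟩
  rw [hP x _ .univ]
  have hs : 0 < ∑ i, w x i := Finset.sum_pos (fun i _ => hpos x i) ⟨⟨0, hN⟩, Finset.mem_univ _⟩
  simp only [Set.mem_univ, Set.ofPred_true, measure_univ, one_mul]
  simp only [selectionProb]
  rw [← ENNReal.ofReal_sum_of_nonneg fun i _ => div_nonneg (hpos x i).le hs.le]
  rw [← Finset.sum_div, div_self hs.ne', ENNReal.ofReal_one]

variable {μ : Measure α} {w : (Fin N → α) → Fin N → ℝ} {P : Kernel (Fin N → α) (Fin N → α)}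

/-- First-step lower bound: select the index `j` and replace the corresponding point. -/
lemma IsThinningReplacementKernel.le_pow_succ_apply (hP : IsThinningReplacementKernel μ w P)
    (n : ℕ) (x : Fin N → α) (j : Fin N) {A : Set (Fin N → α)} (hA : MeasurableSet A) :
    ENNReal.ofReal (selectionProb w x j) * ∫⁻ z, (P ^ n) (Function.update x j z) A ∂μ ≤
      (P ^ (n + 1)) x A := by
  have hle : ENNReal.ofReal (selectionProb w x j) • μ.map (Function.update x j) ≤ P x := by
    refine Measure.le_iff.2 fun s hs => ?_
    rw [hP x s hs, Measure.smul_apply, Measure.map_apply (measurable_update x) hs, smul_eq_mul,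
      mul_comm]
    exact Finset.single_le_sum
      (f := fun j => μ {z | Function.update x j z ∈ s} * ENNReal.ofReal (selectionProb w x j))
      (fun _ _ => zero_le) (Finset.mem_univ j)
  have hm : Measurable fun y => (P ^ n) y A := (P ^ n).measurable_coe hA
  rw [add_comm n 1, Kernel.pow_add_apply_eq_lintegral P 1 n x hA, pow_one,
    ← lintegral_map hm (measurable_update x), ← smul_eq_mul, ← lintegral_smul_measure]
  exact lintegral_mono' hle le_rfl

/-- If the points whose indices lie in `s` can be replaced one after the other, the `i`-th one by
a point of `B i`, in such a way that each selection has probability at least `δ`, then the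
`#s`-step transition probabilities are bounded below by an iterated integral. -/
lemma IsThinningReplacementKernel.lmarginal_le_pow_apply [IsFiniteMeasure μ]
    (hP : IsThinningReplacementKernel μ w P) {δ : ℝ} {B : Fin N → Set α}
    (hB : ∀ i, MeasurableSet (B i)) (D : Finset (Fin N) → (Fin N → α) → Prop)
    (hD : ∀ s, ∀ j ∉ s, ∀ x, D (insert j s) x →
      δ ≤ selectionProb w x j ∧ ∀ z ∈ B j, D s (Function.update x j z))
    {A : Set (Fin N → α)} (hA : MeasurableSet A) (s : Finset (Fin N)) (x : Fin N → α) (hx : D s x) :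
    ENNReal.ofReal δ ^ s.card * lmarginal (fun i => μ.restrict (B i)) s (A.indicator 1) x ≤
      (P ^ s.card) x A := by
  induction s using Finset.induction_on generalizing x with
  | empty =>
    simp only [Finset.card_empty, pow_zero, one_mul, lmarginal_empty]
    exact (Kernel.id_apply x ▸ (Measure.dirac_apply' x hA).symm.le :
      _ ≤ (Kernel.id : Kernel (Fin N → α) (Fin N → α)) x A)
  -- `s` holds the indices still to be replaced after `j`; the move of `j` comes first and is the
  -- outermost integral.
  | insert j s hj ih =>
    obtain ⟨hsel, hnext⟩ := hD s j hj x hx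
    rw [Finset.card_insert_of_notMem hj,
      lmarginal_insert _ (measurable_one.indicator hA) hj, pow_succ', mul_assoc]
    refine le_trans ?_ (hP.le_pow_succ_apply s.card x j hA)
    gcongr
    rw [← lintegral_const_mul']
    · refine le_trans ?_ (setLIntegral_le_lintegral (B j) _)
      exact setLIntegral_mono' (hB j) fun z hz => ih _ (hnext z hz)
    · finiteness

/-- Once every coordinate has been integrated out, the lower bound no longer depends on the starting
configuration. -/
lemma IsThinningReplacementKernel.pi_le_pow_apply [IsFiniteMeasure μ]
    (hP : IsThinningReplacementKernel μ w P) {δ : ℝ} {B : Fin N → Set α}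
    (hB : ∀ i, MeasurableSet (B i)) (D : Finset (Fin N) → (Fin N → α) → Prop)
    (hD : ∀ s, ∀ j ∉ s, ∀ x, D (insert j s) x →
      δ ≤ selectionProb w x j ∧ ∀ z ∈ B j, D s (Function.update x j z))
    {A : Set (Fin N → α)} (hA : MeasurableSet A) (x : Fin N → α) (hx : D Finset.univ x) :
    ENNReal.ofReal δ ^ N * Measure.pi (fun i => μ.restrict (B i)) A ≤ (P ^ N) x A := by
  have h := hP.lmarginal_le_pow_apply hB D hD hA Finset.univ x hx
  simpa only [Finset.card_univ, Fintype.card_fin, lmarginal_univ, lintegral_indicator_one hA]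
    using h

/-- If the points can be replaced one after the other, in some order that may depend on chance,
by points that keep the configuration good, then a lower bound for the transition probabilities
from completely good configurations yields one from all configurations. -/
lemma IsThinningReplacementKernel.mul_le_pow_apply (hP : IsThinningReplacementKernel μ w P)
    {δ : ℝ} {ρ : ℝ≥0∞} (Good : Finset (Fin N) → (Fin N → α) → Prop)
    (hstep : ∀ G x, G ≠ Finset.univ → Good G x → ∃ j ∉ G, δ ≤ selectionProb w x j ∧
      ∃ Z, MeasurableSet Z ∧ ρ ≤ μ Z ∧ ∀ z ∈ Z, Good (insert j G) (Function.update x j z))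
    {n : ℕ} {A : Set (Fin N → α)} (hA : MeasurableSet A) {c : ℝ≥0∞}
    (hc : ∀ x, Good Finset.univ x → c ≤ (P ^ n) x A) (l : ℕ) (G : Finset (Fin N))
    (hl : Gᶜ.card = l) (x : Fin N → α) (hx : Good G x) :
    (ENNReal.ofReal δ * ρ) ^ l * c ≤ (P ^ (n + l)) x A := by
  induction l generalizing G x with
  | zero =>
    have hG : G = Finset.univ := by
      rwa [Finset.card_eq_zero, Finset.compl_eq_empty_iff] at hl
    subst hG
    simpa using hc x hx
  | succ l ih =>
    have hG : G ≠ Finset.univ := by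
      rintro rfl
      simp at hl
    obtain ⟨j, hj, hsel, Z, hZ, hρ, hgood⟩ := hstep G x hG hx
    have hcard : (insert j G)ᶜ.card = l := by
      rw [Finset.compl_insert, Finset.card_erase_of_mem (Finset.mem_compl.2 hj), hl]; rfl
    rw [← add_assoc]
    refine le_trans ?_ (hP.le_pow_succ_apply (n + l) x j hA)
    rw [pow_succ', mul_assoc, mul_assoc]
    gcongr
    calc ρ * ((ENNReal.ofReal δ * ρ) ^ l * c)
        ≤ ∫⁻ _ in Z, (ENNReal.ofReal δ * ρ) ^ l * c ∂μ := by
          rw [setLIntegral_const, mul_comm]; gcongr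
      _ ≤ ∫⁻ z in Z, (P ^ (n + l)) (Function.update x j z) A ∂μ :=
          setLIntegral_mono' hZ fun z hz => ih _ hcard _ (hgood z hz)
      _ ≤ _ := setLIntegral_le_lintegral _ _

end ThinningReplacement

/-! ### Geodesic distance and volume on a piecewise-`C²` manifold -/

section GeodesicDist

variable {m : ℕ} {M : Set (EuclideanSpace ℝ (Fin m))}

lemma geodesicDist_self (x : M) : geodesicDist x x = 0 := by
  refine le_antisymm ((iInf_le _ (Path.refl x)).trans_eq ?_) zero_le
  refine eVariationOn.constant_on ?_
  rintro _ ⟨s, _, rfl⟩ _ ⟨t, _, rfl⟩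
  rfl

lemma edist_le_geodesicDist (x y : M) : edist x y ≤ geodesicDist x y := by
  refine le_iInf fun γ => ?_
  have := eVariationOn.edist_le (fun t => (γ t : EuclideanSpace ℝ (Fin m)))
    (Set.mem_univ (0 : unitInterval)) (Set.mem_univ 1)
  simpa [Subtype.edist_eq] using this

lemma geodesicDist_le_symm (x y : M) : geodesicDist x y ≤ geodesicDist y x := by
  refine le_iInf fun γ => (iInf_le _ γ.symm).trans ?_
  exact eVariationOn.comp_le_of_antitoneOn (fun t => (γ t : EuclideanSpace ℝ (Fin m)))
    unitInterval.symm (fun a _ b _ hab => unitInterval.symm_le_symm.2 hab)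
    (Set.mapsTo_univ _ _)

lemma geodesicDist_comm (x y : M) : geodesicDist x y = geodesicDist y x :=
  (geodesicDist_le_symm x y).antisymm (geodesicDist_le_symm y x)

/-- The length of a concatenation splits at 1/2, and each half is a monotone reparametrization of
one of the two curves. -/
lemma geodesicDist_triangle (x y z : M) :
    geodesicDist x z ≤ geodesicDist x y + geodesicDist y z := by
  unfold geodesicDist
  refine ENNReal.le_iInf_add_iInf fun γ γ' => (iInf_le _ (γ.trans γ')).trans ?_
  let h : unitInterval := ⟨1 / 2, by norm_num, by norm_num⟩
  have hsplit := eVariationOn.union (fun t => ((γ.trans γ') t : EuclideanSpace ℝ (Fin m)))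
    (isGreatest_Iic (a := h)) (isLeast_Ici (a := h))
  rw [Set.Iic_union_Ici] at hsplit
  rw [hsplit]
  have hmono (c : ℝ) :
      Monotone fun t : unitInterval => Set.projIcc (0 : ℝ) 1 zero_le_one (2 * (t : ℝ) - c) := by
    intro s t hst
    refine Set.monotone_projIcc _ ?_
    have : (s : ℝ) ≤ t := hst
    linarith
  gcongr
  · refine le_trans (eVariationOn.congr fun t ht => ?_).le (eVariationOn.comp_le_of_monotoneOn
      (fun t => (γ t : EuclideanSpace ℝ (Fin m))) _ ((hmono 0).monotoneOn _) (Set.mapsTo_univ _ _))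
    have ht' : (t : ℝ) ≤ 1 / 2 := ht
    simp only [Path.trans_apply, dif_pos ht', Function.comp, sub_zero]
    rw [Set.projIcc_of_mem]
  · refine le_trans (eVariationOn.congr fun t ht => ?_).le (eVariationOn.comp_le_of_monotoneOn
      (fun t => (γ' t : EuclideanSpace ℝ (Fin m))) _ ((hmono 1).monotoneOn _)
      (Set.mapsTo_univ _ _))
    have ht' : (1 / 2 : ℝ) ≤ t := ht
    simp only [Path.trans_apply, Function.comp]
    split_ifs with hle
    -- At 1/2 the concatenation is given by the first curve, but both curves pass through `y` there.
    · have he : (t : ℝ) = 1 / 2 := le_antisymm hle ht'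
      simp [he]
    · rw [Set.projIcc_of_mem]

/-- The geodesic distance is continuous as soon as it tends to `0` at each point. -/
lemma continuous_geodesicDist_of_tendsto
    (h : ∀ x : M, Tendsto (fun y => geodesicDist y x) (𝓝 x) (𝓝 0)) :
    Continuous fun p : M × M => geodesicDist p.1 p.2 := by
  rw [continuous_iff_continuousAt]
  rintro ⟨x, y⟩
  have h1 : Tendsto (fun p : M × M => geodesicDist p.1 x + geodesicDist p.2 y) (𝓝 (x, y)) (𝓝 0) := by
    simpa using ((h x).comp (continuous_fst.tendsto' (x, y) x rfl)).add
      ((h y).comp (continuous_snd.tendsto' (x, y) y rfl))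
  have hup (p : M × M) : geodesicDist p.1 p.2 ≤
      geodesicDist x y + (geodesicDist p.1 x + geodesicDist p.2 y) := by
    calc _ ≤ geodesicDist p.1 x + (geodesicDist x y + geodesicDist y p.2) :=
          (geodesicDist_triangle _ x _).trans (by gcongr; exact geodesicDist_triangle _ _ _)
      _ = _ := by rw [geodesicDist_comm y p.2]; ring
  have hlow (p : M × M) : geodesicDist x y ≤
      geodesicDist p.1 p.2 + (geodesicDist p.1 x + geodesicDist p.2 y) := by
    calc _ ≤ geodesicDist x p.1 + (geodesicDist p.1 p.2 + geodesicDist p.2 y) :=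
          (geodesicDist_triangle _ p.1 _).trans (by gcongr; exact geodesicDist_triangle _ _ _)
      _ = _ := by rw [geodesicDist_comm x p.1]; ring
  refine tendsto_of_tendsto_of_tendsto_of_le_of_le
    (g := fun p => geodesicDist x y - (geodesicDist p.1 x + geodesicDist p.2 y))
    (h := fun p => geodesicDist x y + (geodesicDist p.1 x + geodesicDist p.2 y))
    ?_ ?_ (fun p => tsub_le_iff_right.2 (hlow p)) hup
  -- The squeeze also works at infinite distance: `∞` minus a quantity tending to 0 tends to `∞`.
  · simpa using ENNReal.Tendsto.sub tendsto_const_nhds h1 (Or.inr ENNReal.zero_ne_top)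
  · simpa using tendsto_const_nhds.add h1

variable {k : ℕ} {K : Set (EuclideanSpace ℝ (Fin k))}
  {φ : EuclideanSpace ℝ (Fin k) → EuclideanSpace ℝ (Fin m)}

/-- The derivative is bounded on the compact set `K`, and the mean value inequality applies by
convexity. -/
lemma IsC2Piece.exists_lipschitzOnWith (h : IsC2Piece K φ) : ∃ L, LipschitzOnWith L φ K := by
  have hu : UniqueDiffOn ℝ K := uniqueDiffOn_convex h.convex h.nonempty_interior
  have hc : ContinuousOn (fun a => fderivWithin ℝ φ K a) K :=
    h.contDiffOn.continuousOn_fderivWithin hu (by norm_num)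
  obtain ⟨C, hC⟩ := h.isCompact.exists_bound_of_continuousOn hc
  refine ⟨C.toNNReal, h.convex.lipschitzOnWith_of_nnnorm_fderivWithin_le
    (h.contDiffOn.differentiableOn (by norm_num)) fun a ha => ?_⟩
  exact NNReal.coe_le_coe.1 ((hC a ha).trans (Real.le_coe_toNNReal C))

/-- The curve is the image of the segment from `a` to `b`, which stays in `K` by convexity. -/
lemma geodesicDist_le_of_lipschitzOnWith (hK : Convex ℝ K) {L : NNReal}
    (hL : LipschitzOnWith L φ K) {x y : M} {a b : EuclideanSpace ℝ (Fin k)} (ha : a ∈ K)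
    (hb : b ∈ K) (hx : φ a = x) (hy : φ b = y) (hM : ∀ c ∈ K, φ c ∈ M) :
    geodesicDist x y ≤ L * edist a b := by
  have hmem (t : unitInterval) : AffineMap.lineMap a b (t : ℝ) ∈ K :=
    hK.lineMap_mem ha hb t.2
  let γ : Path x y :=
    { toFun := fun t => ⟨φ (AffineMap.lineMap a b (t : ℝ)), hM _ (hmem t)⟩
      continuous_toFun := by
        refine Continuous.subtype_mk (hL.continuousOn.comp_continuous ?_ hmem) _
        exact AffineMap.lineMap_continuous.comp continuous_subtype_val
      source' := Subtype.ext (by simpa using hx)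
      target' := Subtype.ext (by simpa using hy) }
  refine (iInf_le _ γ).trans ?_
  have h1 : LipschitzOnWith (L * nndist a b)
      (fun t : ℝ => φ (AffineMap.lineMap a b t)) (Set.Icc 0 1) :=
    hL.comp ((lipschitzWith_lineMap a b).lipschitzOnWith) fun t ht => hmem ⟨t, ht⟩
  have h2 := h1.comp_eVariationOn_le (g := fun t : unitInterval => (t : ℝ)) (s := Set.univ)
    (fun t _ => t.2)
  have h3 : eVariationOn (fun t : unitInterval => (t : ℝ)) Set.univ = 1 := by
    have hm : MonotoneOn (fun t : unitInterval => (t : ℝ)) Set.univ := fun s _ t _ hst => hst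
    have := hm.eVariationOn_eq (Set.mem_univ 0) (Set.mem_univ 1)
    rw [Set.univ_inter] at this
    have he : Set.Icc (0 : unitInterval) 1 = Set.univ :=
      Set.eq_univ_of_forall fun t => ⟨unitInterval.nonneg', unitInterval.le_one'⟩
    rw [he] at this
    simpa using this
  calc _ ≤ ((L * nndist a b : NNReal) : ℝ≥0∞) * eVariationOn (fun t : unitInterval => (t : ℝ)) Set.univ := h2
    _ = L * edist a b := by rw [h3, mul_one, ENNReal.coe_mul, edist_nndist]

/-- A `C²` piece has a Lipschitz inverse near an interior point. -/
lemma IsC2Piece.exists_antilipschitz (h : IsC2Piece K φ) {a : EuclideanSpace ℝ (Fin k)}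
    (ha : a ∈ interior K) :
    ∃ (C : NNReal) (V : Set (EuclideanSpace ℝ (Fin k))), V ∈ 𝓝 a ∧
      ∀ b ∈ V, ∀ c ∈ V, dist b c ≤ C * dist (φ b) (φ c) := by
  have hcd : ContDiffAt ℝ 2 φ a := h.contDiffOn.contDiffAt (mem_interior_iff_mem_nhds.1 ha)
  have hs : HasStrictFDerivAt φ (fderiv ℝ φ a) a := hcd.hasStrictFDerivAt (by norm_num)
  obtain ⟨C, hC0, hC⟩ := (fderiv ℝ φ a).toLinearMap.exists_antilipschitzWith
    (LinearMap.ker_eq_bot.2 (h.immersive a ha))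
  -- With this constant the linearization error, multiplied by `C`, is half of `‖b - c‖` and can be
  -- absorbed.
  have hpos : (0 : NNReal) < (2 * C)⁻¹ := by positivity
  obtain ⟨V, hV, happ⟩ := hs.approximates_deriv_on_nhds (c := (2 * C)⁻¹) (Or.inr hpos)
  refine ⟨2 * C, V, hV, fun b hb c hc => ?_⟩
  have h1 : ‖φ b - φ c - fderiv ℝ φ a (b - c)‖ ≤ ((2 * C)⁻¹ : NNReal) * ‖b - c‖ :=
    happ b hb c hc
  have h2 : ‖b - c‖ ≤ C * ‖fderiv ℝ φ a (b - c)‖ := by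
    simpa [dist_eq_norm] using hC.le_mul_dist (b - c) 0
  have h3 : ‖fderiv ℝ φ a (b - c)‖ ≤ ‖φ b - φ c‖ + ‖φ b - φ c - fderiv ℝ φ a (b - c)‖ := by
    have := norm_sub_le (φ b - φ c) (φ b - φ c - fderiv ℝ φ a (b - c))
    simpa using this
  have hCr : (0 : ℝ) < C := hC0
  rw [dist_eq_norm, dist_eq_norm]
  have h4 : (C : ℝ) * (((2 * C)⁻¹ : NNReal) * ‖b - c‖) = ‖b - c‖ / 2 := by
    push_cast; field_simp
  push_cast
  nlinarith [mul_le_mul_of_nonneg_left h1 hCr.le, mul_le_mul_of_nonneg_left h3 hCr.le]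

lemma hausdorffMeasure_ne_zero_of_isOpen {U : Set (EuclideanSpace ℝ (Fin k))} (hU : IsOpen U)
    (hne : U.Nonempty) : Measure.hausdorffMeasure (k : ℝ) U ≠ 0 := by
  have h := (isAddHaarMeasure_hausdorffMeasure (E := EuclideanSpace ℝ (Fin k)))
  rw [finrank_euclideanSpace_fin] at h
  exact (hU.measure_pos _ hne).ne'

/-- A neighbourhood of a point of a piece contains the image of an open set of interior points. -/
lemma IsC2Piece.exists_mem_interior_of_isOpen (h : IsC2Piece K φ) (hMem : ∀ c ∈ K, φ c ∈ M)
    {U : Set M} (hU : IsOpen U) {a : EuclideanSpace ℝ (Fin k)} (ha : a ∈ K)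
    (haU : (⟨φ a, hMem a ha⟩ : M) ∈ U) :
    ∃ W : Set (EuclideanSpace ℝ (Fin k)), IsOpen W ∧ W.Nonempty ∧ W ⊆ interior K ∧
      ∀ c (hc : c ∈ K), c ∈ W → (⟨φ c, hMem c hc⟩ : M) ∈ U := by
  obtain ⟨U', hU', rfl⟩ := isOpen_induced_iff.1 hU
  have hcont : ContinuousOn φ (interior K) := h.contDiffOn.continuousOn.mono interior_subset
  refine ⟨interior K ∩ φ ⁻¹' U', hcont.isOpen_inter_preimage isOpen_interior hU', ?_,
    Set.inter_subset_left, fun c _ hcW => hcW.2⟩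
  -- `a` may be a boundary point, where `φ` need not be immersive; a convex body is the closure of
  -- its interior.
  have hcl : a ∈ closure (interior K) :=
    (h.convex.closure_interior_eq_closure_of_nonempty_interior h.nonempty_interior).symm ▸
      subset_closure ha
  have hev : ∀ᶠ c in 𝓝[interior K] a, φ c ∈ U' :=
    ((h.contDiffOn.continuousOn a ha).mono interior_subset).eventually (hU'.mem_nhds haU)
  have : (𝓝[interior K] a).NeBot := mem_closure_iff_nhdsWithin_neBot.1 hcl
  obtain ⟨c, hc1, hc2⟩ := (hev.and self_mem_nhdsWithin).exists
  exact ⟨c, hc2, hc1⟩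

variable [NeZero k]

/-- In each piece, the parameters at distance at least δ from all preimages of `x` have a compact
image avoiding `x`. So a point close to `x` has, in any piece containing it, a parameter within δ of
a preimage of `x`, and the Lipschitz bound applies. A piece not containing `x` is excluded
altogether. -/
lemma IsCompactPiecewiseC2Manifold.tendsto_geodesicDist (hM : IsCompactPiecewiseC2Manifold k M)
    (x : M) : Tendsto (fun y => geodesicDist y x) (𝓝 x) (𝓝 0) := by
  obtain ⟨r, K, φ, hp, hU⟩ := hM.pieces
  have hmem (i : Fin r) : ∀ c ∈ K i, φ i c ∈ M := fun c hc => by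
    rw [hU]; exact Set.mem_iUnion_of_mem i (Set.mem_image_of_mem _ hc)
  choose L hL using fun i => (hp i).exists_lipschitzOnWith
  rw [ENNReal.tendsto_nhds_zero]
  intro ε hε
  obtain ⟨δ, hδ, hδ'⟩ : ∃ δ : ℝ, 0 < δ ∧ ∀ i, (L i : ℝ≥0∞) * ENNReal.ofReal δ ≤ ε := by
    obtain ⟨ε', hε', hε'ε⟩ := ENNReal.lt_iff_exists_nnreal_btwn.1 hε
    have hS : (0 : ℝ) < (∑ i, L i : NNReal) + 1 := by positivity
    have hε'0 : (0 : ℝ) < ε' := by exact_mod_cast hε'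
    refine ⟨ε' / ((∑ i, L i : NNReal) + 1), by positivity, fun i => le_trans ?_ hε'ε.le⟩
    rw [← ENNReal.ofReal_coe_nnreal, ← ENNReal.ofReal_mul (by positivity),
      ← ENNReal.ofReal_coe_nnreal]
    refine ENNReal.ofReal_le_ofReal ?_
    rw [mul_div_assoc', div_le_iff₀ hS, mul_comm]
    have : (L i : ℝ) ≤ (∑ i, L i : NNReal) := by
      exact_mod_cast Finset.single_le_sum (f := L) (fun _ _ => zero_le) (Finset.mem_univ i)
    nlinarith
  let Q : Fin r → Set (EuclideanSpace ℝ (Fin m)) := fun i =>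
    φ i '' (K i ∩ {b | ∀ a ∈ K i, φ i a = x → δ ≤ dist b a})
  have hQc (i : Fin r) : IsClosed (Q i) := by
    refine IsCompact.isClosed (IsCompact.image_of_continuousOn ?_
      ((hp i).contDiffOn.continuousOn.mono Set.inter_subset_left))
    refine (hp i).isCompact.inter_right ?_
    simp only [Set.ofPred_forall]
    exact isClosed_iInter fun a => isClosed_iInter fun _ => isClosed_iInter fun _ =>
      isClosed_le continuous_const (continuous_id.dist continuous_const)
  have hx : (x : EuclideanSpace ℝ (Fin m)) ∈ (⋃ i, Q i)ᶜ := by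
    simp only [Set.mem_compl_iff, Set.mem_iUnion, not_exists]
    rintro i ⟨b, ⟨hb, hb'⟩, hbx⟩
    have := hb' b hb hbx
    rw [dist_self] at this
    linarith
  have hopen : IsOpen (⋃ i, Q i)ᶜ := (isClosed_iUnion_of_finite hQc).isOpen_compl
  filter_upwards [(hopen.preimage continuous_subtype_val).mem_nhds hx] with y hy
  have hyM : (y : EuclideanSpace ℝ (Fin m)) ∈ ⋃ i, φ i '' K i := hU ▸ y.2
  obtain ⟨i, b, hb, hby⟩ := Set.mem_iUnion.1 hyM
  have hnot : ¬ ∀ a ∈ K i, φ i a = x → δ ≤ dist b a := fun hcon =>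
    hy (Set.mem_iUnion_of_mem i ⟨b, ⟨hb, hcon⟩, hby⟩)
  push Not at hnot
  obtain ⟨a, ha, hax, hlt⟩ := hnot
  refine (geodesicDist_le_of_lipschitzOnWith (hp i).convex (hL i) hb ha hby hax (hmem i)).trans
    (le_trans ?_ (hδ' i))
  gcongr
  rw [edist_dist]
  exact ENNReal.ofReal_le_ofReal hlt.le

lemma IsCompactPiecewiseC2Manifold.continuous_geodesicDist
    (hM : IsCompactPiecewiseC2Manifold k M) :
    Continuous fun p : M × M => geodesicDist p.1 p.2 :=
  continuous_geodesicDist_of_tendsto hM.tendsto_geodesicDist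

/-- Part of `U` is mapped onto a nonempty open subset of `ℝᵏ` by a Lipschitz local inverse of a
piece. Lipschitz maps preserve null sets of Hausdorff measure, so `U` cannot be null. -/
lemma IsCompactPiecewiseC2Manifold.manifoldVolume_ne_zero
    (hM : IsCompactPiecewiseC2Manifold k M) {U : Set M} (hU : IsOpen U) (hne : U.Nonempty) :
    manifoldVolume k M U ≠ 0 := by
  obtain ⟨r, K, φ, hp, hUn⟩ := hM.pieces
  have hmem (i : Fin r) : ∀ c ∈ K i, φ i c ∈ M := fun c hc => by
    rw [hUn]; exact Set.mem_iUnion_of_mem i (Set.mem_image_of_mem _ hc)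
  obtain ⟨x, hx⟩ := hne
  have hxM : (x : EuclideanSpace ℝ (Fin m)) ∈ ⋃ i, φ i '' K i := hUn ▸ x.2
  obtain ⟨i, a, ha, hax⟩ := Set.mem_iUnion.1 hxM
  obtain ⟨W, hWo, ⟨c, hcW⟩, hWK, hWU⟩ := (hp i).exists_mem_interior_of_isOpen (hmem i) hU ha
    (by convert! hx)
  obtain ⟨C, V, hV, hVC⟩ := (hp i).exists_antilipschitz (hWK hcW)
  obtain ⟨V', hV'V, hV'o, hcV'⟩ := mem_nhds_iff.1 hV
  let g : M → EuclideanSpace ℝ (Fin k) := fun y => Function.invFunOn (φ i) (W ∩ V') y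
  let T : Set M := {y | ∃ b ∈ W ∩ V', φ i b = y}
  have hg (y : M) (hy : y ∈ T) : g y ∈ W ∩ V' ∧ φ i (g y) = y :=
    ⟨Function.invFunOn_mem hy, Function.invFunOn_eq hy⟩
  have hTU : T ⊆ U := by
    rintro y ⟨b, hb, hby⟩
    convert! hWU b (interior_subset (hWK hb.1)) hb.1
    exact hby.symm
  have hlip : LipschitzOnWith C g T := by
    refine LipschitzOnWith.of_dist_le_mul fun y hy z hz => ?_
    have := hVC (g y) (hV'V (hg y hy).1.2) (g z) (hV'V (hg z hz).1.2)
    rwa [(hg y hy).2, (hg z hz).2] at this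
  have hsurj : W ∩ V' ⊆ g '' T := by
    intro b hb
    have hbK := interior_subset (hWK hb.1)
    have hbT : (⟨φ i b, hmem i b hbK⟩ : M) ∈ T := ⟨b, hb, rfl⟩
    refine ⟨_, hbT, ?_⟩
    have := hg _ hbT
    exact (hp i).injOn (interior_subset (hWK this.1.1)) hbK this.2
  intro h0
  have hH : Measure.hausdorffMeasure (k : ℝ) U = 0 := by
    rw [manifoldVolume, Measure.euclideanHausdorffMeasure_def, Measure.smul_apply] at h0
    rcases smul_eq_zero.1 h0 with h | h
    · exact absurd h (Measure.addHaarScalarFactor_volume_hausdorffMeasure_ne_zero k)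
    · exact h
  refine hausdorffMeasure_ne_zero_of_isOpen (hWo.inter hV'o) ⟨c, hcW, hcV'⟩ ?_
  have hle := hlip.hausdorffMeasure_image_le (d := (k : ℝ)) (Nat.cast_nonneg k)
  rw [measure_mono_null hTU hH, mul_zero] at hle
  exact measure_mono_null hsurj (le_antisymm hle zero_le)

lemma IsCompactPiecewiseC2Manifold.infinite (hM : IsCompactPiecewiseC2Manifold k M)
    [hne : Nonempty M] : Infinite M := by
  obtain ⟨r, K, φ, hp, hUn⟩ := hM.pieces
  obtain ⟨x⟩ := hne
  have hxM : (x : EuclideanSpace ℝ (Fin m)) ∈ ⋃ i, φ i '' K i := hUn ▸ x.2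
  obtain ⟨i, -⟩ := Set.mem_iUnion.1 hxM
  have hmem : ∀ c ∈ K i, φ i c ∈ M := fun c hc => by
    rw [hUn]; exact Set.mem_iUnion_of_mem i (Set.mem_image_of_mem _ hc)
  obtain ⟨a, ha⟩ := (hp i).nonempty_interior
  have hinf : (K i).Infinite := infinite_of_mem_nhds a (mem_interior_iff_mem_nhds.1 ha)
  exact Set.infinite_coe_iff.2 ((hinf.image (hp i).injOn).mono (Set.image_subset_iff.2 hmem))

end GeodesicDist

/-! ### Voronoi cells: volume, measurability and separation -/

section VoronoiCells

variable {m N : ℕ} {M : Set (EuclideanSpace ℝ (Fin m))}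

/-- The open ball of radius `η` around `p` for the geodesic distance. -/
def geodesicBall (p : M) (η : ℝ≥0∞) : Set M := {y | geodesicDist y p < η}

lemma mem_geodesicBall_self (p : M) {η : ℝ≥0∞} (hη : 0 < η) : p ∈ geodesicBall p η := by
  simpa [geodesicBall, geodesicDist_self] using hη

lemma isOpen_geodesicBall (hd : Continuous fun p : M × M => geodesicDist p.1 p.2) (p : M)
    (η : ℝ≥0∞) : IsOpen (geodesicBall p η) :=
  isOpen_lt (hd.comp (continuous_id.prodMk continuous_const)) continuous_const

lemma mem_configCell {x : Fin N → M} {j : Fin N} {y : M} :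
    y ∈ configCell x j ↔ ∀ i, geodesicDist y (x j) ≤ geodesicDist y (x i) := by
  simp [configCell, voronoiCell]

/-- In a compact manifold, balls of a given radius have measures bounded below. -/
lemma exists_pos_le_measureReal_geodesicBall [CompactSpace M] [Nonempty M]
    (hd : Continuous fun p : M × M => geodesicDist p.1 p.2) (ν : Measure M) [IsFiniteMeasure ν]
    (hν : ∀ U : Set M, IsOpen U → U.Nonempty → ν U ≠ 0) {η : ℝ≥0∞} (hη : 0 < η) :
    ∃ β : ℝ, 0 < β ∧ ∀ p : M, β ≤ ν.real (geodesicBall p η) := by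
  have hη2 : 0 < η / 2 := ENNReal.half_pos hη.ne'
  obtain ⟨t, ht⟩ := isCompact_univ.elim_finite_subcover (fun c : M => geodesicBall c (η / 2))
    (fun c => isOpen_geodesicBall hd c _)
    fun y _ => Set.mem_iUnion.2 ⟨y, mem_geodesicBall_self y hη2⟩
  have hcov (p : M) : ∃ c ∈ t, p ∈ geodesicBall c (η / 2) := by
    simpa using ht (Set.mem_univ p)
  obtain ⟨c₀, hc₀, -⟩ := hcov (Classical.arbitrary M)
  obtain ⟨c, -, hc⟩ := Finset.exists_min_image t (fun c => ν.real (geodesicBall c (η / 2))) ⟨c₀, hc₀⟩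
  refine ⟨ν.real (geodesicBall c (η / 2)), ?_, fun p => ?_⟩
  · exact ENNReal.toReal_pos (hν _ (isOpen_geodesicBall hd c _) ⟨c, mem_geodesicBall_self c hη2⟩)
      (measure_ne_top _ _)
  · obtain ⟨c', hc't, hpc'⟩ := hcov p
    refine (hc c' hc't).trans (measureReal_mono (fun y hy => ?_))
    calc geodesicDist y p ≤ geodesicDist y c' + geodesicDist c' p := geodesicDist_triangle _ _ _
      _ < η / 2 + η / 2 := ENNReal.add_lt_add hy (by rw [geodesicDist_comm]; exact hpc')
      _ = η := ENNReal.add_halves η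

lemma isClosed_setOf_mem_configCell (hd : Continuous fun p : M × M => geodesicDist p.1 p.2)
    (j : Fin N) : IsClosed {p : (Fin N → M) × M | p.2 ∈ configCell p.1 j} := by
  simp only [mem_configCell, Set.ofPred_forall]
  refine isClosed_iInter fun i => isClosed_le ?_ ?_
  · exact hd.comp (continuous_snd.prodMk ((continuous_apply j).comp continuous_fst))
  · exact hd.comp (continuous_snd.prodMk ((continuous_apply i).comp continuous_fst))

/-- A Voronoi cell has positive measure, also if some of the generators coincide. -/
lemma measure_configCell_ne_zero (hd : Continuous fun p : M × M => geodesicDist p.1 p.2)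
    {ν : Measure M} (hν : ∀ U : Set M, IsOpen U → U.Nonempty → ν U ≠ 0) (x : Fin N → M)
    (j : Fin N) : ν (configCell x j) ≠ 0 := by
  have hsub : (⋂ i, {y | x i = x j ∨ geodesicDist y (x j) < geodesicDist y (x i)}) ⊆
      configCell x j := by
    intro y hy
    rw [mem_configCell]
    intro i
    rcases Set.mem_iInter.1 hy i with h | h
    · rw [h]
    · exact h.le
  refine fun h0 => hν _ (isOpen_iInter_of_finite fun i => ?_) ⟨x j, ?_⟩ (measure_mono_null hsub h0)
  · by_cases h : x i = x j
    · simp [h]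
    · simp only [h, false_or]
      exact isOpen_lt (hd.comp (continuous_id.prodMk continuous_const))
        (hd.comp (continuous_id.prodMk continuous_const))
  · refine Set.mem_iInter.2 fun i => or_iff_not_imp_left.2 fun h => ?_
    rw [geodesicDist_self]
    exact (edist_pos.2 (Ne.symm h)).trans_le (edist_le_geodesicDist _ _)

lemma measureReal_configCell_mem_Ioc (hd : Continuous fun p : M × M => geodesicDist p.1 p.2)
    {ν : Measure M} [IsFiniteMeasure ν] (hν : ∀ U : Set M, IsOpen U → U.Nonempty → ν U ≠ 0)
    (x : Fin N → M) (j : Fin N) : ν.real (configCell x j) ∈ Set.Ioc 0 (ν.real Set.univ) :=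
  ⟨ENNReal.toReal_pos (measure_configCell_ne_zero hd hν x j) (measure_ne_top _ _),
    measureReal_mono (Set.subset_univ _)⟩

lemma measurable_volumeWeight (hd : Continuous fun p : M × M => geodesicDist p.1 p.2)
    (lam : Measure M) [IsFiniteMeasure lam]
    (hlam : ∀ U : Set M, IsOpen U → U.Nonempty → lam U ≠ 0) {S : ℝ → ℝ}
    (hS : Measurable fun v : Set.Ioc 0 (lam.real Set.univ) => S v) (j : Fin N) :
    Measurable fun x : Fin N → M => volumeWeight lam S x j := by
  have h1 : Measurable fun x : Fin N → M => lam (configCell x j) :=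
    measurable_measure_prodMk_left (isClosed_setOf_mem_configCell hd j).measurableSet
  exact hS.comp (h1.ennreal_toReal.subtype_mk
    (h := fun x => measureReal_configCell_mem_Ioc hd hlam x j))

/-- Whether two cells have more than one common point depends measurably on the configuration. -/
lemma measurableSet_nontrivial_configCell_inter [CompactSpace M]
    (hd : Continuous fun p : M × M => geodesicDist p.1 p.2) (i j : Fin N) :
    MeasurableSet {x : Fin N → M | (configCell x i ∩ configCell x j).Nontrivial} := by
  -- Requiring distance at least `1 / (n + 1)` makes the condition closed; projecting along the
  -- compact factor keeps it closed.
  let T : ℕ → Set ((Fin N → M) × (M × M)) := fun n =>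
    {p | (p.2.1 ∈ configCell p.1 i ∧ p.2.1 ∈ configCell p.1 j) ∧
      (p.2.2 ∈ configCell p.1 i ∧ p.2.2 ∈ configCell p.1 j) ∧
      1 / ((n : ℝ) + 1) ≤ dist p.2.1 p.2.2}
  have hT (n : ℕ) : IsClosed (T n) := by
    have hc (l : Fin N) := isClosed_setOf_mem_configCell hd l
    have h1 : Continuous fun p : (Fin N → M) × (M × M) => (p.1, p.2.1) := by fun_prop
    have h2 : Continuous fun p : (Fin N → M) × (M × M) => (p.1, p.2.2) := by fun_prop
    exact (((hc i).preimage h1).inter ((hc j).preimage h1)).inter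
      ((((hc i).preimage h2).inter ((hc j).preimage h2)).inter
        (isClosed_le continuous_const (continuous_snd.fst.dist continuous_snd.snd)))
  have heq : {x : Fin N → M | (configCell x i ∩ configCell x j).Nontrivial} =
      ⋃ n, Prod.fst '' T n := by
    ext x
    simp only [Set.mem_iUnion, Set.mem_image]
    constructor
    · rintro ⟨y, hy, z, hz, hne⟩
      obtain ⟨n, hn⟩ := exists_nat_one_div_lt (dist_pos.2 hne)
      exact ⟨n, (x, (y, z)), ⟨hy, hz, hn.le⟩, rfl⟩
    · rintro ⟨n, ⟨x', y, z⟩, ⟨hy, hz, hn⟩, rfl⟩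
      refine ⟨y, hy, z, hz, dist_pos.1 (lt_of_lt_of_le ?_ hn)⟩
      positivity
  rw [heq]
  exact MeasurableSet.iUnion fun n =>
    ((hT n).isCompact.image continuous_fst).isClosed.measurableSet

/-- The number of neighbours depends measurably on the configuration. -/
lemma measurable_ncard_voronoiNeighbours [CompactSpace M]
    (hd : Continuous fun p : M × M => geodesicDist p.1 p.2) (j : Fin N) :
    Measurable fun x : Fin N → M => (voronoiNeighbours x j).ncard := by
  -- The neighbours are counted as points, not indices, so coincidences matter. The count depends
  -- only on this finite pattern of coincidences and adjacencies: each index is replaced by its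
  -- coincidence class.
  let E : (Fin N → M) → (Fin N → Fin N → Prop) × (Fin N → Prop) := fun x =>
    (fun i l => x i = x l, fun i => i ≠ j ∧ (configCell x i ∩ configCell x j).Nontrivial)
  have hE : Measurable E := by
    refine Measurable.prodMk (measurable_pi_lambda _ fun i => measurable_pi_lambda _ fun l => ?_)
      (measurable_pi_lambda _ fun i => ?_)
    · exact measurableSet_setOfPred.1
        (isClosed_eq (continuous_apply i) (continuous_apply l)).measurableSet
    · exact measurable_const.and
        (measurableSet_setOfPred.1 (measurableSet_nontrivial_configCell_inter hd i j))
  let f : (Fin N → Fin N → Prop) × (Fin N → Prop) → ℕ := fun e =>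
    ((fun i => {l | e.1 i l}) '' {i | e.2 i}).ncard
  have hf : (fun x : Fin N → M => (voronoiNeighbours x j).ncard) = f ∘ E := by
    funext x
    have h1 : voronoiNeighbours x j =
        x '' {i | i ≠ j ∧ (configCell x i ∩ configCell x j).Nontrivial} := by
      ext p
      constructor
      · rintro ⟨i, hij, rfl, h⟩; exact ⟨i, ⟨hij, h⟩, rfl⟩
      · rintro ⟨i, ⟨hij, h⟩, rfl⟩; exact ⟨i, hij, rfl, h⟩
    have h2 : (fun i => {l | x i = x l}) = (fun p : M => {l | p = x l}) ∘ x := rfl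
    simp only [Function.comp, f, E]
    rw [h1, h2, Set.image_comp]
    refine (Set.InjOn.ncard_image ?_).symm
    rintro _ ⟨a, _, rfl⟩ _ ⟨b, _, rfl⟩ hab
    have : a ∈ {l | x a = x l} := rfl
    rw [show {l | x a = x l} = {l | x b = x l} from hab] at this
    exact this.symm
  rw [hf]
  exact (Measurable.of_discrete (f := f)).comp hE

lemma ncard_voronoiNeighbours_lt (x : Fin N → M) (j : Fin N) :
    (voronoiNeighbours x j).ncard < N := by
  have hsub : voronoiNeighbours x j ⊆ x '' {j}ᶜ := by
    rintro p ⟨i, hij, rfl, -⟩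
    exact ⟨i, hij, rfl⟩
  have h1 : (voronoiNeighbours x j).ncard ≤ ({j}ᶜ : Set (Fin N)).ncard :=
    (Set.ncard_le_ncard hsub (Set.toFinite _)).trans (Set.ncard_image_le (Set.toFinite _))
  have h2 := Set.ncard_add_ncard_compl ({j} : Set (Fin N))
  rw [Set.ncard_singleton, Nat.card_eq_fintype_card, Fintype.card_fin] at h2
  exact h1.trans_lt (by lia)

/-- The ball around a point which is far from all the others lies in the cell of the point. -/
lemma geodesicBall_subset_configCell {x : Fin N → M} {i : Fin N} {η : ℝ≥0∞}
    (h : ∀ j ≠ i, 2 * η ≤ geodesicDist (x i) (x j)) : geodesicBall (x i) η ⊆ configCell x i := by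
  intro y hy
  rw [mem_configCell]
  intro j
  by_contra! hlt
  have hji : j ≠ i := by rintro rfl; exact lt_irrefl _ hlt
  refine (h j hji).not_gt ?_
  calc geodesicDist (x i) (x j) ≤ geodesicDist (x i) y + geodesicDist y (x j) :=
        geodesicDist_triangle _ _ _
    _ < η + η := ENNReal.add_lt_add (by rw [geodesicDist_comm]; exact hy) (hlt.trans hy)
    _ = 2 * η := (two_mul η).symm

/-- If the points with indices in `G` are far from all others, then the ball around another point
is covered by the cells of the points with indices outside `G`. -/
lemma geodesicBall_subset_iUnion_configCell {x : Fin N → M} {G : Finset (Fin N)} {η : ℝ≥0∞}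
    (h : ∀ i ∈ G, ∀ j ≠ i, 2 * η ≤ geodesicDist (x i) (x j)) {l : Fin N} (hl : l ∉ G) :
    geodesicBall (x l) η ⊆ ⋃ i ∈ Gᶜ, configCell x i := by
  intro y hy
  obtain ⟨i, -, hi⟩ := Finset.exists_min_image Finset.univ (fun i => geodesicDist y (x i))
    ⟨l, Finset.mem_univ _⟩
  refine Set.mem_biUnion (x := i) ?_ (mem_configCell.2 fun j => hi j (Finset.mem_univ j))
  rw [Finset.mem_coe, Finset.mem_compl]
  intro hiG
  have hli : l ≠ i := by rintro rfl; exact hl hiG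
  refine (h i hiG l hli).not_gt ?_
  calc geodesicDist (x i) (x l) ≤ geodesicDist (x i) y + geodesicDist y (x l) :=
        geodesicDist_triangle _ _ _
    _ < η + η := ENNReal.add_lt_add
        (by rw [geodesicDist_comm]; exact (hi l (Finset.mem_univ l)).trans_lt hy) hy
    _ = 2 * η := (two_mul η).symm

/-- At most `N` cells, all with indices outside `G`, cover a ball of measure at least `β`. -/
lemma exists_le_measureReal_configCell {x : Fin N → M} {G : Finset (Fin N)} {η : ℝ≥0∞}
    (h : ∀ i ∈ G, ∀ j ≠ i, 2 * η ≤ geodesicDist (x i) (x j)) (hG : G ≠ Finset.univ)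
    {ν : Measure M} [IsFiniteMeasure ν] {β : ℝ} (hβ0 : 0 < β)
    (hβ : ∀ p : M, β ≤ ν.real (geodesicBall p η)) :
    ∃ j ∉ G, β / N ≤ ν.real (configCell x j) := by
  obtain ⟨l, hl⟩ : ∃ l, l ∉ G := by
    by_contra! hcon
    exact hG (Finset.eq_univ_iff_forall.2 hcon)
  have hNpos : (0 : ℝ) < N := Nat.cast_pos.2 l.pos
  by_contra! hcon
  have h1 : ν.real (⋃ i ∈ Gᶜ, configCell x i) ≤ ∑ i ∈ Gᶜ, ν.real (configCell x i) :=
    measureReal_biUnion_finset_le _ _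
  have h2 : ∑ i ∈ Gᶜ, ν.real (configCell x i) < ∑ i ∈ Gᶜ, β / N :=
    Finset.sum_lt_sum_of_nonempty ⟨l, Finset.mem_compl.2 hl⟩
      fun i hi => hcon i (Finset.mem_compl.1 hi)
  have h3 : ∑ i ∈ Gᶜ, β / N ≤ β := by
    rw [Finset.sum_const, nsmul_eq_mul, mul_div_assoc', div_le_iff₀ hNpos, mul_comm]
    gcongr
    simpa using Finset.card_le_univ Gᶜ
  have h4 : β ≤ ν.real (⋃ i ∈ Gᶜ, configCell x i) :=
    (hβ (x l)).trans (measureReal_mono (geodesicBall_subset_iUnion_configCell h hl)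
      (measure_ne_top _ _))
  linarith

lemma two_mul_le_geodesicDist_of_mem_geodesicBall {c y z : M} {η : ℝ≥0∞}
    (hz : z ∈ geodesicBall c η) (hy : 3 * η ≤ geodesicDist c y) : 2 * η ≤ geodesicDist z y := by
  by_contra! hlt
  refine hy.not_gt ?_
  calc geodesicDist c y ≤ geodesicDist c z + geodesicDist z y := geodesicDist_triangle _ _ _
    _ < η + 2 * η := ENNReal.add_lt_add (by rw [geodesicDist_comm]; exact hz) hlt
    _ = 3 * η := by ring

lemma two_mul_le_geodesicDist_of_mem_of_mem {c c' y z : M} {η : ℝ≥0∞}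
    (hz : z ∈ geodesicBall c η) (hy : y ∈ geodesicBall c' η) (h : 6 * η ≤ geodesicDist c c') :
    2 * η ≤ geodesicDist z y := by
  refine two_mul_le_geodesicDist_of_mem_geodesicBall hz ?_
  by_contra! hlt
  refine h.not_gt ?_
  calc geodesicDist c c' ≤ geodesicDist c y + geodesicDist y c' := geodesicDist_triangle _ _ _
    _ < 3 * η + η := ENNReal.add_lt_add hlt hy
    _ ≤ 3 * η + 3 * η := by gcongr; exact le_mul_of_one_le_left zero_le (by norm_num)
    _ = 6 * η := by ring

/-- Among more than `N` widely separated centres, some centre is far from `N` given points. -/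
lemma exists_center_far {ι : Type*} [Fintype ι] (hι : N < Fintype.card ι) {c : ι → M}
    {η : ℝ≥0∞} (hc : ∀ p q, p ≠ q → 6 * η ≤ geodesicDist (c p) (c q)) (x : Fin N → M) :
    ∃ p, ∀ i, 3 * η ≤ geodesicDist (c p) (x i) := by
  by_contra! hcon
  choose f hf using hcon
  -- Otherwise each centre is within `3 * η` of some point, and two centres share such a point.
  obtain ⟨p, q, hpq, hfpq⟩ := Fintype.exists_ne_map_eq_of_card_lt f (by simpa using hι)
  refine (hc p q hpq).not_gt ?_
  calc geodesicDist (c p) (c q) ≤ geodesicDist (c p) (x (f p)) + geodesicDist (x (f p)) (c q) :=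
        geodesicDist_triangle _ _ _
    _ < 3 * η + 3 * η := ENNReal.add_lt_add (hf p)
        (by rw [geodesicDist_comm, hfpq]; exact hf q)
    _ = 6 * η := by ring

/-- The factor 6 ensures that no point is closer than `3 * η` to two centres. A margin of `3 * η` at
a centre leaves `2 * η` throughout its `η`-ball, which is the separation that controls the cells. -/
lemma exists_separated_family (ι : Type*) [Fintype ι] [Infinite M] :
    ∃ (c : ι → M) (η : ℝ≥0∞), 0 < η ∧ ∀ p q, p ≠ q → 6 * η ≤ geodesicDist (c p) (c q) := by
  let e : ι ↪ M := (Fintype.equivFin ι).toEmbedding.trans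
    (Fin.valEmbedding.trans (Infinite.natEmbedding M))
  have hlim : Tendsto (fun η : ℝ≥0∞ => 6 * η) (𝓝[>] 0) (𝓝 0) := by
    have : Tendsto (fun η : ℝ≥0∞ => 6 * η) (𝓝 0) (𝓝 (6 * 0)) :=
      ENNReal.Tendsto.const_mul tendsto_id (Or.inr (by norm_num))
    rw [mul_zero] at this
    exact this.mono_left nhdsWithin_le_nhds
  have hev : ∀ᶠ η in 𝓝[>] (0 : ℝ≥0∞), ∀ p q, p ≠ q → 6 * η ≤ geodesicDist (e p) (e q) := by
    refine eventually_all.2 fun p => eventually_all.2 fun q => ?_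
    by_cases hpq : p = q
    · simp [hpq]
    · have hpos : 0 < geodesicDist (e p) (e q) :=
        (edist_pos.2 (e.injective.ne hpq)).trans_le (edist_le_geodesicDist _ _)
      filter_upwards [hlim.eventually (gt_mem_nhds hpos)] with η hη _ using hη.le
  obtain ⟨η, hη, hη0⟩ := (hev.and self_mem_nhdsWithin).exists
  exact ⟨e, η, hη0, hη⟩

end VoronoiCells

lemma LocallyBoundedOn.exists_bound {f : ℝ → ℝ} {s K : Set ℝ} (hf : LocallyBoundedOn f s)
    (hK : IsCompact K) (hKs : K ⊆ s) : ∃ C, ∀ v ∈ K, |f v| ≤ C := by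
  refine hK.induction_on (p := fun t => ∃ C, ∀ v ∈ t, |f v| ≤ C) ⟨0, by simp⟩
    (fun s t hst ⟨C, hC⟩ => ⟨C, fun v hv => hC v (hst hv)⟩)
    (fun s t ⟨C, hC⟩ ⟨C', hC'⟩ => ⟨max C C', ?_⟩) (fun v hv => ?_)
  · rintro v (hv | hv)
    · exact (hC v hv).trans (le_max_left _ _)
    · exact (hC' v hv).trans (le_max_right _ _)
  · obtain ⟨C, hC⟩ := hf v (hKs hv)
    exact ⟨_, hC.filter_mono (nhdsWithin_mono v hKs), C, fun u hu => hu⟩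

/-! ### Doeblin's condition for the two processes -/

section Processes

variable {m N : ℕ} {M : Set (EuclideanSpace ℝ (Fin m))} {μ : Measure M}

/-- The `n`-process satisfies Doeblin's condition, since its selection probabilities are bounded
below. -/
lemma isHarrisErgodic_neighbourWeight [NeZero N] [IsProbabilityMeasure μ] {S : ℕ → ℝ}
    (hS : ∀ n < N, 0 < S n) {P : Kernel (Fin N → M) (Fin N → M)} [IsMarkovKernel P]
    (hP : IsThinningReplacementKernel μ (neighbourWeight S) P) : IsHarrisErgodic P := by
  have hne : (Finset.range N).Nonempty := Finset.nonempty_range_iff.2 (NeZero.ne N)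
  obtain ⟨a, ha, hmin⟩ := Finset.exists_min_image (Finset.range N) S hne
  obtain ⟨b, hb, hmax⟩ := Finset.exists_max_image (Finset.range N) S hne
  have ha0 : 0 < S a := hS a (Finset.mem_range.1 ha)
  have hb0 : 0 < S b := hS b (Finset.mem_range.1 hb)
  have hmem (x : Fin N → M) (j : Fin N) : (voronoiNeighbours x j).ncard ∈ Finset.range N :=
    Finset.mem_range.2 (ncard_voronoiNeighbours_lt x j)
  have hNpos : (0 : ℝ) < N := Nat.cast_pos.2 (NeZero.pos N)
  have hδ : 0 < ENNReal.ofReal (S a / (N * S b)) := ENNReal.ofReal_pos.2 (by positivity)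
  have hsel (x : Fin N → M) (j : Fin N) :
      S a / (N * S b) ≤ selectionProb (neighbourWeight S) x j :=
    le_selectionProb (fun i => hS _ (ncard_voronoiNeighbours_lt x i))
      (fun i => hmax _ (hmem x i)) (hmin _ (hmem x j))
  have hcf : ENNReal.ofReal (S a / (N * S b)) ^ N ≠ ∞ := by finiteness
  have hfin := Measure.smul_finite (Measure.pi fun _ : Fin N => μ.restrict Set.univ) hcf
  refine isHarrisErgodic_of_minorized P N (ENNReal.ofReal (S a / (N * S b)) ^ N •
    Measure.pi fun _ : Fin N => μ.restrict Set.univ) ?_ fun x A hA =>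
      -- The selection bound holds at every configuration, so no invariant has to be maintained.
      hP.pi_le_pow_apply (fun _ => .univ) (fun _ _ => True)
        (fun _ j _ x _ => ⟨hsel x j, fun _ _ => trivial⟩) hA x trivial
  rw [← Measure.measure_univ_ne_zero, Measure.smul_apply, Measure.pi_univ]
  simpa using pow_ne_zero N hδ.ne'

/-- Replacing a point by one that is far from the other points preserves separation. -/
lemma separated_update {x : Fin N → M} {G : Finset (Fin N)} {η : ℝ≥0∞} {j : Fin N} {z : M}
    (h : ∀ i ∈ G, ∀ l ≠ i, 2 * η ≤ geodesicDist (x i) (x l))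
    (hz : ∀ l ≠ j, 2 * η ≤ geodesicDist z (x l)) :
    ∀ i ∈ insert j G, ∀ l ≠ i, 2 * η ≤
      geodesicDist (Function.update x j z i) (Function.update x j z l) := by
  intro i hi l hli
  by_cases hij : i = j
  · subst hij
    rw [Function.update_self, Function.update_of_ne hli]
    exact hz l hli
  · rw [Function.update_of_ne hij]
    by_cases hlj : l = j
    · subst hlj
      rw [Function.update_self, geodesicDist_comm]
      exact hz i hij
    · rw [Function.update_of_ne hlj]
      exact h i (Finset.mem_of_mem_insert_of_ne hi hij) l hli

/-- The `v`-process satisfies Doeblin's condition: in `N` steps the points can be moved into small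
balls far from each other, and in `N` further steps into prescribed balls. -/
lemma isHarrisErgodic_volumeWeight [NeZero N] [CompactSpace M] [Infinite M]
    [IsProbabilityMeasure μ] (hd : Continuous fun p : M × M => geodesicDist p.1 p.2)
    (hμ : ∀ U : Set M, IsOpen U → U.Nonempty → μ U ≠ 0)
    {lam : Measure M} [IsFiniteMeasure lam]
    (hlam : ∀ U : Set M, IsOpen U → U.Nonempty → lam U ≠ 0) {S : ℝ → ℝ}
    (hpos : ∀ v ∈ Set.Ioc 0 (lam.real Set.univ), 0 < S v)
    (hS : LocallyBoundedOn S (Set.Ioc 0 (lam.real Set.univ)))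
    (hS' : LocallyBoundedOn (fun v => 1 / S v) (Set.Ioc 0 (lam.real Set.univ)))
    {P : Kernel (Fin N → M) (Fin N → M)} [IsMarkovKernel P]
    (hP : IsThinningReplacementKernel μ (volumeWeight lam S) P) : IsHarrisErgodic P := by
  -- `Sum.inl i` is the target centre of the `i`-th point; the `N + 1` centres `Sum.inr p` are for
  -- parking, one more than there are points.
  obtain ⟨c, η, hη, hsep⟩ := exists_separated_family (M := M) (Fin N ⊕ Fin (N + 1))
  obtain ⟨β, hβ0, hβ⟩ := exists_pos_le_measureReal_geodesicBall hd lam hlam hη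
  obtain ⟨ρ, hρ0, hρ⟩ := exists_pos_le_measureReal_geodesicBall hd μ hμ hη
  have hNpos : (0 : ℝ) < N := Nat.cast_pos.2 (NeZero.pos N)
  have hβN : 0 < β / N := by positivity
  have hβN' : β / N ≤ β := div_le_self hβ0.le (by exact_mod_cast NeZero.one_le)
  have hsub : Set.Icc (β / N) (lam.real Set.univ) ⊆ Set.Ioc 0 (lam.real Set.univ) :=
    fun v hv => ⟨hβN.trans_le hv.1, hv.2⟩
  -- Local boundedness becomes boundedness on this compact interval: `S` gives the upper bound, `1 /
  -- S` the lower one.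
  obtain ⟨a, C, ha0, haC, hbound⟩ : ∃ a C : ℝ, 0 < a ∧ a ≤ C ∧
      ∀ v ∈ Set.Icc (β / N) (lam.real Set.univ), a ≤ S v ∧ S v ≤ C := by
    obtain ⟨C₀, hC₀⟩ := hS.exists_bound isCompact_Icc hsub
    obtain ⟨C₁, hC₁⟩ := hS'.exists_bound isCompact_Icc hsub
    have h1 : 0 < max C₁ 1 := lt_max_of_lt_right one_pos
    refine ⟨1 / max C₁ 1, max C₀ (1 / max C₁ 1), by positivity, le_max_right _ _,
      fun v hv => ⟨?_, ((le_abs_self _).trans (hC₀ v hv)).trans (le_max_left _ _)⟩⟩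
    have h2 : 1 / S v ≤ max C₁ 1 := ((le_abs_self _).trans (hC₁ v hv)).trans (le_max_left _ _)
    exact (one_div_le (hpos v (hsub hv)) h1).1 h2
  have hw (x : Fin N → M) (i : Fin N) : 0 < volumeWeight lam S x i :=
    hpos _ (measureReal_configCell_mem_Ioc hd hlam x i)
  have hwb (x : Fin N → M) (i : Fin N) (h : β / N ≤ lam.real (configCell x i)) :
      a ≤ volumeWeight lam S x i ∧ volumeWeight lam S x i ≤ C :=
    hbound _ ⟨h, measureReal_mono (Set.subset_univ _)⟩
  have hcell (x : Fin N → M) (i : Fin N) (h : ∀ j ≠ i, 2 * η ≤ geodesicDist (x i) (x j)) :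
      β / N ≤ lam.real (configCell x i) :=
    hβN'.trans ((hβ (x i)).trans (measureReal_mono (geodesicBall_subset_configCell h)))
  set δ : ℝ := a / (N * C)
  have hδ : 0 < δ := div_pos ha0 (mul_pos hNpos (ha0.trans_le haC))
  have hballm (q : Fin N ⊕ Fin (N + 1)) : MeasurableSet (geodesicBall (c q) η) :=
    (isOpen_geodesicBall hd _ _).measurableSet
  -- First round: `G` is the set of indices already parked, each of these points being separated
  -- from all others, parked or not.
  let Good : Finset (Fin N) → (Fin N → M) → Prop := fun G x =>
    (∀ i ∈ G, ∃ p, x i ∈ geodesicBall (c (Sum.inr p)) η) ∧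
      ∀ i ∈ G, ∀ l ≠ i, 2 * η ≤ geodesicDist (x i) (x l)
  have hGood : ∀ G x, G ≠ Finset.univ → Good G x →
      ∃ j ∉ G, δ ≤ selectionProb (volumeWeight lam S) x j ∧
        ∃ Z, MeasurableSet Z ∧ ENNReal.ofReal ρ ≤ μ Z ∧
          ∀ z ∈ Z, Good (insert j G) (Function.update x j z) := by
    rintro G x hG ⟨hpark, hfar⟩
    obtain ⟨l, hlG, hl⟩ := exists_le_measureReal_configCell hfar hG hβ0 hβ
    obtain ⟨j, hjG, hj⟩ := exists_le_selectionProb (hw x)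
      (fun i hi => (hwb x i (hcell x i (hfar i hi))).2) ha0 haC ⟨l, hlG, (hwb x l hl).1⟩
    obtain ⟨p, hp⟩ := exists_center_far (c := fun p : Fin (N + 1) => c (Sum.inr p)) (by simp)
      (fun p q hpq => hsep _ _ (Sum.inr_injective.ne hpq)) x
    refine ⟨j, hjG, hj, geodesicBall (c (Sum.inr p)) η, hballm _, ?_, fun z hz => ⟨?_, ?_⟩⟩
    · exact (ENNReal.ofReal_le_iff_le_toReal (measure_ne_top _ _)).2 (hρ _)
    · intro i hi
      by_cases hij : i = j
      · subst hij
        exact ⟨p, by rwa [Function.update_self]⟩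
      · rw [Function.update_of_ne hij]
        exact hpark i (Finset.mem_of_mem_insert_of_ne hi hij)
    · exact separated_update hfar fun l _ => two_mul_le_geodesicDist_of_mem_geodesicBall hz (hp l)
  -- Second round: the indices in `s` are still parked, the others have reached their targets, and
  -- all points stay separated.
  let D : Finset (Fin N) → (Fin N → M) → Prop := fun s x =>
    (∀ i ∉ s, x i ∈ geodesicBall (c (Sum.inl i)) η) ∧
      (∀ i ∈ s, ∃ p, x i ∈ geodesicBall (c (Sum.inr p)) η) ∧
      ∀ i ∈ Finset.univ, ∀ l ≠ i, 2 * η ≤ geodesicDist (x i) (x l)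
  have hD : ∀ s, ∀ j ∉ s, ∀ x, D (insert j s) x →
      δ ≤ selectionProb (volumeWeight lam S) x j ∧
        ∀ z ∈ geodesicBall (c (Sum.inl j)) η, D s (Function.update x j z) := by
    rintro s j hj x ⟨htarget, hpark, hfar⟩
    have hb (i : Fin N) := hwb x i (hcell x i (hfar i (Finset.mem_univ i)))
    refine ⟨le_selectionProb (hw x) (fun i => (hb i).2) (hb j).1, fun z hz => ⟨?_, ?_, ?_⟩⟩
    · intro i hi
      by_cases hij : i = j
      · subst hij
        rwa [Function.update_self]
      · rw [Function.update_of_ne hij]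
        exact htarget i (by simp [hij, hi])
    · intro i hi
      have hij : i ≠ j := by rintro rfl; exact hj hi
      rw [Function.update_of_ne hij]
      exact hpark i (Finset.mem_insert_of_mem hi)
    -- The other points lie in parking balls or in their own target balls, all centred far from the
    -- target of `j`.
    · have hz' : ∀ l ≠ j, 2 * η ≤ geodesicDist z (x l) := by
        intro l hlj
        by_cases hl : l ∈ s
        · obtain ⟨p, hp⟩ := hpark l (Finset.mem_insert_of_mem hl)
          exact two_mul_le_geodesicDist_of_mem_of_mem hz hp (hsep _ _ Sum.inl_ne_inr)
        · exact two_mul_le_geodesicDist_of_mem_of_mem hz (htarget l (by simp [hlj, hl]))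
            (hsep _ _ (Sum.inl_injective.ne hlj.symm))
      have := separated_update hfar hz'
      rwa [Finset.insert_eq_of_mem (Finset.mem_univ j)] at this
  let π : Measure (Fin N → M) := Measure.pi fun i => μ.restrict (geodesicBall (c (Sum.inl i)) η)
  -- Each parking move contributes a selection and a ball probability. In the second round only the
  -- selections are counted, the ball probabilities being part of `π`.
  let b : ℝ≥0∞ := (ENNReal.ofReal δ * ENNReal.ofReal ρ) ^ N * ENNReal.ofReal δ ^ N
  have hb : b ≠ ∞ := by finiteness
  have hb0 : b ≠ 0 := by
    have h1 := (ENNReal.ofReal_pos.2 hδ).ne'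
    have h2 := (ENNReal.ofReal_pos.2 hρ0).ne'
    exact mul_ne_zero (pow_ne_zero _ (mul_ne_zero h1 h2)) (pow_ne_zero _ h1)
  have hfin := Measure.smul_finite π hb
  refine isHarrisErgodic_of_minorized P (N + N) (b • π) ?_ fun x A hA => ?_
  · rw [← Measure.measure_univ_ne_zero, Measure.smul_apply, smul_eq_mul, Measure.pi_univ]
    refine mul_ne_zero hb0 (Finset.prod_ne_zero_iff.2 fun i _ => ?_)
    rw [Measure.restrict_apply_univ]
    exact hμ _ (isOpen_geodesicBall hd _ _) ⟨_, mem_geodesicBall_self _ hη⟩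
  · rw [Measure.smul_apply, smul_eq_mul, mul_assoc]
    exact hP.mul_le_pow_apply Good hGood hA
      (fun y hy => hP.pi_le_pow_apply (fun i => hballm _) D hD hA y
        ⟨fun i hi => absurd (Finset.mem_univ i) hi, hy.1, hy.2⟩) N ∅ (by simp) x
      ⟨by simp, by simp⟩

end Processes

theorem theorem1 (m k N : ℕ) [NeZero k] (hN : 1 ≤ N)
    (M : Set (EuclideanSpace ℝ (Fin m))) (hM : IsCompactPiecewiseC2Manifold k M)
    (μ : Measure M) [IsProbabilityMeasure μ] (hμ : EquivalentMeasures μ (manifoldVolume k M)) :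
    (∀ S : ℕ → ℝ, (∀ n < N, 0 < S n) →
      ∃ (P : Kernel (Fin N → M) (Fin N → M)) (_ : IsMarkovKernel P),
        IsThinningReplacementKernel μ (neighbourWeight S) P ∧ IsHarrisErgodic P) ∧
    (∀ (lam : Measure M) [IsFiniteMeasure lam], EquivalentMeasures lam (manifoldVolume k M) →
      ∀ S : ℝ → ℝ, Measurable (fun v : Set.Ioc 0 (lam.real Set.univ) => S v) →
        (∀ v ∈ Set.Ioc 0 (lam.real Set.univ), 0 < S v) →
        LocallyBoundedOn S (Set.Ioc 0 (lam.real Set.univ)) →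
        LocallyBoundedOn (fun v => 1 / S v) (Set.Ioc 0 (lam.real Set.univ)) →
        ∃ (P : Kernel (Fin N → M) (Fin N → M)) (_ : IsMarkovKernel P),
          IsThinningReplacementKernel μ (volumeWeight lam S) P ∧ IsHarrisErgodic P) := by
  have hNe : NeZero N := ⟨by lia⟩
  have hcomp : CompactSpace M := isCompact_iff_compactSpace.1 hM.isCompact
  have hd := hM.continuous_geodesicDist
  have hne : Nonempty M := nonempty_of_isProbabilityMeasure μ
  have hinf : Infinite M := hM.infinite
  have hopen {ν : Measure M} (hν : EquivalentMeasures ν (manifoldVolume k M)) :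
      ∀ U : Set M, IsOpen U → U.Nonempty → ν U ≠ 0 :=
    fun U hU hUne h0 => hM.manifoldVolume_ne_zero hU hUne (hν.2 h0)
  refine ⟨fun S hS => ?_, fun lam _ hlam S hSm hpos hSb hSb' => ?_⟩
  · obtain ⟨P, hPM, hP⟩ := exists_thinningReplacementKernel hN μ
      (w := neighbourWeight (M := M) S)
      (fun j => (Measurable.of_discrete (f := S)).comp (measurable_ncard_voronoiNeighbours hd j))
      (fun x j => hS _ (ncard_voronoiNeighbours_lt x j))
    exact ⟨P, hPM, hP, isHarrisErgodic_neighbourWeight hS hP⟩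
  · obtain ⟨P, hPM, hP⟩ := exists_thinningReplacementKernel hN μ
      (w := volumeWeight lam S)
      (measurable_volumeWeight hd lam (hopen hlam) hSm)
      (fun x j => hpos _ (measureReal_configCell_mem_Ioc hd (hopen hlam) x j))
    exact ⟨P, hPM, hP, isHarrisErgodic_volumeWeight hd (hopen hμ) (hopen hlam) hpos hSb hSb' hP⟩
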